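/- Let $p\in\{1,2\}$. For integers $n,d\ge 1$, reals $a<b$, a product distribution $\mathcal D=\prod_{i=1}^d\mathcal D_i$ on $[n]^d$ and a function $f:[n]^d\to[a,b]$, define the $L_p$-distance of $f$ to monotonicity by $$d_p(f)=\frac1{b-a}\,\inf_{g}\Big(\mathbf E_{x\sim\mathcal D}\,|f(x)-g(x)|^p\Big)^{1/p},$$ where $g$ ranges over the functions $[n]^d\to\mathbb R$ that are monotone (non-decreasing) with respect to the coordinatewise order. Then $L_p$-testing of monotonicity can be done in time $O\big(\frac d{\varepsilon^p}\log\frac d{\varepsilon^p}\big)$: there are a randomized algorithm and a constant $C$ such that for all $n,d\ge1$, $a<b$, $\varepsilon\in(0,1)$, all product distributions $\mathcal D$ on $[n]^d$ and all $f:[n]^d\to[a,b]$, the algorithm, given $n,d,a,b,\varepsilon$, oracle access to $f$ and independent samples from $\mathcal D$, 1. halts, whatever its random choices, within $C\big(\frac d{\varepsilon^p}\log\frac d{\varepsilon^p}+1\big)$ steps; 2. accepts with probability at least $2/3$ if $f$ is monotone; 3. rejects with probability at least $2/3$ if $d_p(f)>\varepsilon$. Here an algorithm is a program for a random access machine with natural-number,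 real and point registers, and each elementary step takes unit time: an arithmetic operation, a comparison, drawing a uniformly random element of $\{0,\dots,k-1\}$ for a computed $k$, drawing a sample $x\sim\mathcal D$, reading or overwriting one coordinate of a stored point, querying $f$ at a stored point. -/

import Mathlib

namespace LpTesting

noncomputable section

/-! Distances. The hypergrid `[n]^d` is the type `Fin d → Fin n` with the coordinatewise order. -/

/-- The product distribution on `[n]^d` with marginals `D i`. -/
def prodDist {n d : ℕ} (D : Fin d → PMF (Fin n)) : PMF (Fin d → Fin n) :=
  PMF.ofFintype (fun x => ∏ i, D i (x i)) (by
    have h := Finset.prod_univ_sum (fun _ : Fin d => (Finset.univ : Finset (Fin n)))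
      (fun i j => D i j)
    rw [Fintype.piFinset_univ] at h
    rw [← h]
    refine Finset.prod_eq_one fun i _ => ?_
    have hi := (D i).tsum_coe
    rwa [tsum_fintype] at hi)

/-- `(E_{x ∼ μ} |f x - g x|^p)^(1/p)`. -/
def lpDist {α : Type*} [Fintype α] (μ : PMF α) (p : ℕ) (f g : α → ℝ) : ℝ :=
  (∑ x, (μ x).toReal * |f x - g x| ^ p) ^ (1 / (p : ℝ))

/-- The `L_p`-distance of `f` to the set of functions `P`, normalized by the length `r` of the
range. -/
def lpDistTo {α : Type*} [Fintype α] (μ : PMF α) (p : ℕ) (r : ℝ) (f : α → ℝ)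
    (P : Set (α → ℝ)) : ℝ :=
  1 / r * ⨅ g : P, lpDist μ p f g

/-! A randomized real random access machine with oracle access to a function on `[n]^d` and to
independent samples from a distribution on `[n]^d`. It has three memories, each indexed by the
natural numbers: for natural numbers, for reals and for points of `[n]^d`. -/

/-- Elementary operations. The arguments of type `ℕ` are addresses of memory cells, except for the
value `k` in `natConst`. -/
inductive Op : Type
  | natConst (r k : ℕ)
  | natAdd (r s t : ℕ)
  | natSub (r s t : ℕ)
  | natMul (r s t : ℕ)
  /-- indirect addressing: `nat[r] := nat[nat[s]]` -/
  | natLoad (r s : ℕ)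
  /-- indirect addressing: `nat[nat[r]] := nat[s]` -/
  | natStore (r s : ℕ)
  /-- `real[r] := nat[s]` -/
  | cast (r s : ℕ)
  | realAdd (r s t : ℕ)
  | realSub (r s t : ℕ)
  | realMul (r s t : ℕ)
  /-- division, where division by zero gives zero -/
  | realDiv (r s t : ℕ)
  /-- indirect addressing: `real[r] := real[nat[s]]` -/
  | realLoad (r s : ℕ)
  /-- indirect addressing: `real[nat[r]] := real[s]` -/
  | realStore (r s : ℕ)
  /-- `nat[r]` becomes a uniformly random element of `{0, …, nat[s] - 1}` (zero if `nat[s] = 0`) -/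
  | rand (r s : ℕ)
  /-- `pt[q]` becomes a fresh sample from the distribution -/
  | sample (q : ℕ)
  /-- `nat[r] :=` coordinate number `nat[i]` of `pt[q]` (zero if there is no such coordinate) -/
  | getCoord (r q i : ℕ)
  /-- coordinate number `nat[i]` of `pt[q]` is set to `nat[r]` (no effect if out of range) -/
  | setCoord (q i r : ℕ)
  /-- `real[r] := f (pt[q])` -/
  | query (r q : ℕ)

/-- Comparisons on which a program can branch. -/
inductive Test : Type
  | natLt (r s : ℕ)
  | realLt (r s : ℕ)

/-- Programs. A program depends on nothing but the syntax below, so it is uniform in all inputs. -/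
inductive Prog : Type
  | op (o : Op)
  | seq (c₁ c₂ : Prog)
  | cond (t : Test) (c₁ c₂ : Prog)
  | loop (t : Test) (c : Prog)

/-- Memory contents. -/
structure Memory (n d : ℕ) where
  nat : ℕ → ℕ
  real : ℕ → ℝ
  pt : ℕ → Fin d → Fin n

namespace Memory

variable {n d : ℕ}

def setNat (m : Memory n d) (r v : ℕ) : Memory n d :=
  { m with nat := Function.update m.nat r v }

def setReal (m : Memory n d) (r : ℕ) (v : ℝ) : Memory n d :=
  { m with real := Function.update m.real r v }

def setPt (m : Memory n d) (q : ℕ) (x : Fin d → Fin n) : Memory n d :=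
  { m with pt := Function.update m.pt q x }

end Memory

/-- Whether a comparison holds in a memory. -/
def Test.Holds {n d : ℕ} (m : Memory n d) : Test → Prop
  | .natLt r s => m.nat r < m.nat s
  | .realLt r s => m.real r < m.real s

/-- The uniform distribution on `{0, …, k - 1}`; the point mass at zero if `k = 0`. -/
def uniformBelow (k : ℕ) : PMF ℕ :=
  if h : k = 0 then PMF.pure 0
  else PMF.uniformOfFinset (Finset.range k) (Finset.nonempty_range_iff.mpr h)

/-- Coordinate number `i` of `x`. -/
def coord {n d : ℕ} (x : Fin d → Fin n) (i : ℕ) : ℕ :=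
  if h : i < d then (x ⟨i, h⟩ : ℕ) else 0

/-- `x` with coordinate number `i` replaced by `v`. -/
def replaceCoord {n d : ℕ} (x : Fin d → Fin n) (i v : ℕ) : Fin d → Fin n :=
  if h : i < d ∧ v < n then Function.update x ⟨i, h.1⟩ ⟨v, h.2⟩ else x

/-- The effect of an elementary operation, with oracles for `μ` and `f`. -/
def Op.exec {n d : ℕ} (μ : PMF (Fin d → Fin n)) (f : (Fin d → Fin n) → ℝ) (m : Memory n d) :
    Op → PMF (Memory n d)
  | .natConst r k => PMF.pure (m.setNat r k)
  | .natAdd r s t => PMF.pure (m.setNat r (m.nat s + m.nat t))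
  | .natSub r s t => PMF.pure (m.setNat r (m.nat s - m.nat t))
  | .natMul r s t => PMF.pure (m.setNat r (m.nat s * m.nat t))
  | .natLoad r s => PMF.pure (m.setNat r (m.nat (m.nat s)))
  | .natStore r s => PMF.pure (m.setNat (m.nat r) (m.nat s))
  | .cast r s => PMF.pure (m.setReal r (m.nat s : ℝ))
  | .realAdd r s t => PMF.pure (m.setReal r (m.real s + m.real t))
  | .realSub r s t => PMF.pure (m.setReal r (m.real s - m.real t))
  | .realMul r s t => PMF.pure (m.setReal r (m.real s * m.real t))
  | .realDiv r s t => PMF.pure (m.setReal r (m.real s / m.real t))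
  | .realLoad r s => PMF.pure (m.setReal r (m.real (m.nat s)))
  | .realStore r s => PMF.pure (m.setReal (m.nat r) (m.real s))
  | .rand r s => (uniformBelow (m.nat s)).map (m.setNat r)
  | .sample q => μ.map (m.setPt q)
  | .getCoord r q i => PMF.pure (m.setNat r (coord (m.pt q) (m.nat i)))
  | .setCoord q i r => PMF.pure (m.setPt q (replaceCoord (m.pt q) (m.nat i) (m.nat r)))
  | .query r q => PMF.pure (m.setReal r (f (m.pt q)))

/-- A configuration: the programs still to be executed, in order, and the memory. -/
abbrev Config (n d : ℕ) : Type := List Prog × Memory n d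

open Classical in
/-- One step of the machine; every step takes one unit of time. A configuration with nothing left to
execute is halted and stays as it is. -/
def step {n d : ℕ} (μ : PMF (Fin d → Fin n)) (f : (Fin d → Fin n) → ℝ) :
    Config n d → PMF (Config n d)
  | ([], m) => PMF.pure ([], m)
  | (.op o :: k, m) => (o.exec μ f m).map (fun m' => (k, m'))
  | (.seq c₁ c₂ :: k, m) => PMF.pure (c₁ :: c₂ :: k, m)
  | (.cond t c₁ c₂ :: k, m) => PMF.pure ((if t.Holds m then c₁ else c₂) :: k, m)
  | (.loop t c :: k, m) => PMF.pure (if t.Holds m then c :: .loop t c :: k else k, m)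

/-- The distribution of the configuration after `T` steps from `c`. -/
def run {n d : ℕ} (μ : PMF (Fin d → Fin n)) (f : (Fin d → Fin n) → ℝ) :
    ℕ → Config n d → PMF (Config n d)
  | 0, c => PMF.pure c
  | T + 1, c => (step μ f c).bind (run μ f T)

/-- The initial memory of a tester: `n` and `d` are in the cells `nat[1]` and `nat[2]`, and `ε`, `a`,
`b` are in the cells `real[0]`, `real[1]`, `real[2]`. Everything else is zero. -/
def initMemory (n d : ℕ) [NeZero n] (ε a b : ℝ) : Memory n d where
  nat := fun i => if i = 1 then n else if i = 2 then d else 0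
  real := fun i => if i = 0 then ε else if i = 1 then a else if i = 2 then b else 0
  pt := fun _ _ => 0

/-- The configuration distribution after `T` steps of the program `c` on the given inputs, with
sample access to `μ` and query access to `f`. -/
def runTester {n d : ℕ} [NeZero n] (c : Prog) (ε a b : ℝ) (μ : PMF (Fin d → Fin n))
    (f : (Fin d → Fin n) → ℝ) (T : ℕ) : PMF (Config n d) :=
  run μ f T ([c], initMemory n d ε a b)

/-- The program halts within `T` steps, whatever the outcomes of its random choices. -/
def HaltsWithin {n d : ℕ} [NeZero n] (c : Prog) (ε a b : ℝ) (μ : PMF (Fin d → Fin n))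
    (f : (Fin d → Fin n) → ℝ) (T : ℕ) : Prop :=
  ∀ s ∈ (runTester c ε a b μ f T).support, s.1 = []

/-- The probability that within `T` steps the program halts and accepts, that is, `nat[0] = 1`. -/
def acceptProb {n d : ℕ} [NeZero n] (c : Prog) (ε a b : ℝ) (μ : PMF (Fin d → Fin n))
    (f : (Fin d → Fin n) → ℝ) (T : ℕ) : ENNReal :=
  (runTester c ε a b μ f T).toOuterMeasure {s | s.1 = [] ∧ s.2.nat 0 = 1}

/-- The probability that within `T` steps the program halts and rejects, that is, `nat[0] ≠ 1`. -/
def rejectProb {n d : ℕ} [NeZero n] (c : Prog) (ε a b : ℝ) (μ : PMF (Fin d → Fin n))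
    (f : (Fin d → Fin n) → ℝ) (T : ℕ) : ENNReal :=
  (runTester c ε a b μ f T).toOuterMeasure {s | s.1 = [] ∧ s.2.nat 0 ≠ 1}

end

end LpTesting

/-! Clipping `g` to `[a, b]` makes `|f - g| ≤ b - a` pointwise, so the `p`-th moment of the
difference is at most `(b - a) ^ (p - 1)` times its first moment. Hence `d_p(f) > ε` puts `f` at
`L_1`-distance at least `ε ^ p * (b - a)` from monotone, and `L_1` suffices
(`le_sum_abs_of_lt_lpDistTo`).

Reduction to lines: isotonic regression (least-squares projection onto monotone functions) preserves
order and mass, hence contracts `L_1`. Applied to all lines in direction `i`, it makes a function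
monotone in that direction, keeps the other directions that were already monotone, and does not
increase the distance to monotonicity in any direction. Treating the directions one after another
shows that the distance to monotone is at most twice the sum of the directional distances
(`exists_monotone_prodDistL1_le`).

Reduction to Boolean functions: on a line, `f` is within one quantization step of a sum of
indicators of `N` superlevel sets, so its distance to monotone is controlled by the average distance
of these sets to up-sets (`exists_monotone_line_approx`). A set at distance `x` from the up-sets has
members of weight `x / 2` up to some point and non-members of weight `x / 2` beyond it, so about `4
/ x` samples exhibit a violation with probability `1 / 2` (`half_le_detectProb`).

The value of `x` on a random line and threshold is unknown, so round `j + 1` of `N` takes `⌈N / (j +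
1)⌉` samples. A line of error `x` is then caught with probability `1 / 2` in about `N * x / 4` of
the rounds. With `N = ⌈64 * d / ε ^ p⌉` the round detection probabilities sum to at least `2`, and
all rounds miss with probability at most `exp (-2) < 1 / 3`. The harmonic sum of the sample counts
gives the time `O(N log N)`. A monotone `f` is never rejected. -/

namespace LpTesting

open Function

/-! ### Isotonic regression on a finite preorder. -/

section Isotonic

/-- Order preserving, mass preserving maps are contractions in `L_1`. -/
theorem sum_abs_sub_le_of_monotone {α : Type*} [Fintype α] {w : α → ℝ} (hw : ∀ v, 0 < w v) {R : (α → ℝ) → α → ℝ}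
    (hmono : Monotone R) (hmass : ∀ h, ∑ v, w v * R h v = ∑ v, w v * h v) (h h' : α → ℝ) :
    ∑ v, w v * |R h v - R h' v| ≤ ∑ v, w v * |h v - h' v| := by
  -- Both images lie below `R (h ⊔ h')`, which bounds their difference without cancellation. Mass
  -- preservation then removes `R`, and `2 * max s t - s - t = |s - t|`.
  have h1 : ∑ v, w v * |R h v - R h' v| ≤
      ∑ v, (2 * (w v * R (h ⊔ h') v) - w v * R h v - w v * R h' v) := by
    refine Finset.sum_le_sum fun v _ => ?_
    have e : 2 * (w v * R (h ⊔ h') v) - w v * R h v - w v * R h' v =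
        w v * (2 * R (h ⊔ h') v - R h v - R h' v) := by ring
    rw [e]
    refine mul_le_mul_of_nonneg_left ?_ (hw v).le
    have a1 : R h v ≤ R (h ⊔ h') v := hmono le_sup_left v
    have a2 : R h' v ≤ R (h ⊔ h') v := hmono le_sup_right v
    rw [abs_le]
    constructor <;> linarith
  refine h1.trans_eq ?_
  simp only [Finset.sum_sub_distrib, ← Finset.mul_sum, hmass]
  rw [Finset.mul_sum, ← Finset.sum_sub_distrib, ← Finset.sum_sub_distrib]
  refine Finset.sum_congr rfl fun v _ => ?_
  have e : (h ⊔ h') v = max (h v) (h' v) := rfl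
  rw [e]
  rcases le_total (h v) (h' v) with hv | hv
  · rw [max_eq_right hv, abs_of_nonpos (by linarith)]; ring
  · rw [max_eq_left hv, abs_of_nonneg (by linarith)]; ring

variable {α : Type*} [Fintype α] [Preorder α]

/-- The weighted squared distance of two functions. -/
def sqDist (w h g : α → ℝ) : ℝ := ∑ v, w v * (h v - g v) ^ 2

/-- Clamping a competitor to a box that contains the values of `h` keeps it monotone and brings it
no farther from `h`, so minimizing over a compact set is enough. -/
theorem exists_isotonic_minimizer {w : α → ℝ} (hw : ∀ v, 0 < w v) (h : α → ℝ) :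
    ∃ g : α → ℝ, Monotone g ∧ ∀ g', Monotone g' → sqDist w h g ≤ sqDist w h g' := by
  classical
  set M : ℝ := ∑ v, |h v| with hM
  have hle : ∀ v, |h v| ≤ M := fun v =>
    Finset.single_le_sum (f := fun v => |h v|) (fun _ _ => abs_nonneg _) (Finset.mem_univ v)
  have hM0 : 0 ≤ M := Finset.sum_nonneg fun _ _ => abs_nonneg _
  have hclosed : IsClosed {g : α → ℝ | Monotone g} := by
    have : {g : α → ℝ | Monotone g} = ⋂ (x : α) (y : α) (_ : x ≤ y), {g | g x ≤ g y} := by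
      ext g
      simp only [Set.mem_ofPred_eq, Set.mem_iInter]
      exact ⟨fun hg x y hxy => hg hxy, fun hg x y hxy => hg x y hxy⟩
    rw [this]
    exact isClosed_iInter fun x => isClosed_iInter fun y => isClosed_iInter fun _ =>
      isClosed_le (continuous_apply x) (continuous_apply y)
  have hcomp : IsCompact (Set.Icc (fun _ : α => -M) (fun _ => M) ∩ {g | Monotone g}) :=
    isCompact_Icc.inter_right hclosed
  obtain ⟨g, ⟨-, hg⟩, hmin⟩ := hcomp.exists_isMinOn
    (f := fun g => sqDist w h g)
    ⟨fun _ => 0, ⟨fun _ => by simpa using hM0, fun _ => hM0⟩, monotone_const⟩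
    (by unfold sqDist; fun_prop)
  refine ⟨g, hg, fun g' hg' => ?_⟩
  have hclamp : Monotone fun v => max (-M) (min M (g' v)) := fun x y hxy =>
    max_le_max le_rfl (min_le_min le_rfl (hg' hxy))
  refine (hmin (a := fun v => max (-M) (min M (g' v))) ⟨⟨fun v => le_max_left _ _,
    fun v => max_le (by linarith) (min_le_left _ _)⟩, hclamp⟩).trans ?_
  refine Finset.sum_le_sum fun v _ => mul_le_mul_of_nonneg_left ?_ (hw v).le
  have h1 := abs_le.mp (hle v)
  rw [sq_le_sq]
  dsimp only
  rcases le_total M (g' v) with h2 | h2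
  · rw [min_eq_left h2, max_eq_right (by linarith), abs_le]
    constructor <;> cases abs_cases (h v - g' v) <;> linarith
  · rw [min_eq_right h2]
    rcases le_total (-M) (g' v) with h3 | h3
    · rw [max_eq_right h3]
    · rw [max_eq_left h3, abs_le]
      constructor <;> cases abs_cases (h v - g' v) <;> linarith

/-- Strict convexity: the midpoint of two distinct minimizers would be strictly better. -/
theorem isotonic_minimizer_unique {w : α → ℝ} (hw : ∀ v, 0 < w v) {h g g' : α → ℝ}
    (hg : Monotone g) (hmin : ∀ k, Monotone k → sqDist w h g ≤ sqDist w h k)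
    (hg' : Monotone g') (hle : sqDist w h g' ≤ sqDist w h g) : g' = g := by
  have hmid : Monotone fun v => (g v + g' v) / 2 := fun x y hxy => by
    have := hg hxy; have := hg' hxy; dsimp only; linarith
  have h1 := hmin _ hmid
  have h2 : sqDist w h (fun v => (g v + g' v) / 2) =
      (sqDist w h g + sqDist w h g') / 2 - ∑ v, w v * ((g v - g' v) / 2) ^ 2 := by
    simp only [sqDist]
    rw [← Finset.sum_add_distrib, Finset.sum_div, ← Finset.sum_sub_distrib]
    exact Finset.sum_congr rfl fun v _ => by ring
  have h3 : ∑ v, w v * ((g v - g' v) / 2) ^ 2 ≤ 0 := by linarith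
  have hnn : ∀ v ∈ Finset.univ, 0 ≤ w v * ((g v - g' v) / 2) ^ 2 := fun v _ =>
    mul_nonneg (hw v).le (sq_nonneg _)
  have h4 := (Finset.sum_eq_zero_iff_of_nonneg hnn).mp (le_antisymm h3 (Finset.sum_nonneg hnn))
  funext v
  have h5 := h4 v (Finset.mem_univ v)
  have h6 : ((g v - g' v) / 2) ^ 2 = 0 := by
    rcases mul_eq_zero.mp h5 with h | h
    · exact absurd h (hw v).ne'
    · exact h
  have := pow_eq_zero_iff (two_ne_zero) |>.mp h6
  linarith

/-- Isotonic regression is an order preserving, mass preserving retraction onto the monotone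
functions. -/
theorem exists_isotonic_retraction {w : α → ℝ} (hw : ∀ v, 0 < w v) :
    ∃ R : (α → ℝ) → α → ℝ, (∀ h, Monotone (R h)) ∧ (∀ h, Monotone h → R h = h) ∧
      Monotone R ∧ ∀ h, ∑ v, w v * R h v = ∑ v, w v * h v := by
  choose R hR hmin using fun h => exists_isotonic_minimizer hw h
  refine ⟨R, hR, fun h hh => ?_, fun h h' hhh => ?_, fun h => ?_⟩
  · refine (isotonic_minimizer_unique hw (hR h) (hmin h) hh ?_).symm
    have : sqDist w h h = 0 := by simp [sqDist]
    rw [this]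
    exact Finset.sum_nonneg fun v _ => mul_nonneg (hw v).le (sq_nonneg _)
  · have hinf : Monotone fun v => min (R h v) (R h' v) := fun x y hxy =>
      min_le_min (hR h hxy) (hR h' hxy)
    have hsup : Monotone fun v => max (R h v) (R h' v) := fun x y hxy =>
      max_le_max (hR h hxy) (hR h' hxy)
    -- Exchange argument: as `h ≤ h'`, giving the smaller value to `h` and the larger to `h'` does
    -- not raise the total cost. So the minimum of the two regressions is again optimal for `h`, and
    -- uniqueness identifies it with `R h`.
    have hsum : sqDist w h (fun v => min (R h v) (R h' v)) +
        sqDist w h' (fun v => max (R h v) (R h' v)) ≤ sqDist w h (R h) + sqDist w h' (R h') := by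
      simp only [sqDist]
      rw [← Finset.sum_add_distrib, ← Finset.sum_add_distrib]
      refine Finset.sum_le_sum fun v _ => ?_
      rw [← mul_add, ← mul_add]
      refine mul_le_mul_of_nonneg_left ?_ (hw v).le
      have := hhh v
      rcases le_total (R h v) (R h' v) with hv | hv
      · rw [min_eq_left hv, max_eq_right hv]
      · rw [min_eq_right hv, max_eq_left hv]
        nlinarith [mul_nonneg (sub_nonneg.mpr this) (sub_nonneg.mpr hv)]
    have := hmin h' _ hsup
    have heq := isotonic_minimizer_unique hw (hR h) (hmin h) hinf (by linarith)
    intro v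
    have := congrFun heq v
    rw [← this]
    exact min_le_right _ _
  -- Adding a constant keeps a function monotone, so the first variation in that direction vanishes;
  -- this is mass preservation.
  · have hshift : ∀ c : ℝ, 0 ≤ c ^ 2 * ∑ v, w v - 2 * c * ∑ v, w v * (h v - R h v) := by
      intro c
      have h1 := hmin h (fun v => R h v + c) fun x y hxy => by
        have := hR h hxy; dsimp only; linarith
      have h2 : sqDist w h (fun v => R h v + c) = sqDist w h (R h) +
          (c ^ 2 * ∑ v, w v - 2 * c * ∑ v, w v * (h v - R h v)) := by
        simp only [sqDist]
        rw [Finset.mul_sum, Finset.mul_sum, ← Finset.sum_sub_distrib, ← Finset.sum_add_distrib]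
        exact Finset.sum_congr rfl fun v _ => by ring
      linarith
    have hW : 0 ≤ ∑ v, w v := Finset.sum_nonneg fun v _ => (hw v).le
    have hS : ∑ v, w v * (h v - R h v) = 0 := by
      set S := ∑ v, w v * (h v - R h v)
      set W := ∑ v, w v
      -- The optimal shift would be `S / W`; `W + 1` also covers `W = 0`, which occurs when `α` is
      -- empty.
      have h1 := hshift (S / (W + 1))
      have h2 : (S / (W + 1)) ^ 2 * W - 2 * (S / (W + 1)) * S =
          -(S ^ 2 * ((W + 2) / (W + 1) ^ 2)) := by
        field_simp; ring
      rw [h2] at h1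
      have h3 : 0 < (W + 2) / (W + 1) ^ 2 := by positivity
      have h4 : S ^ 2 ≤ 0 := by
        by_contra hcon
        push Not at hcon
        have := mul_pos hcon h3
        linarith
      exact pow_eq_zero_iff two_ne_zero |>.mp (le_antisymm h4 (sq_nonneg _))
    simp only [mul_sub, Finset.sum_sub_distrib] at hS
    linarith

end Isotonic

/-! ### From monotonicity along lines to monotonicity on the grid. -/

section Grid

variable {ι α : Type*} [DecidableEq ι]

/-- Monotonicity along the lines in direction `i`. -/
def DirMono [Preorder α] (i : ι) (f : (ι → α) → ℝ) : Prop :=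
  ∀ x, Monotone fun v => f (update x i v)

theorem monotone_of_dirMono [Fintype ι] [Preorder α] {f : (ι → α) → ℝ}
    (hf : ∀ i, DirMono i f) : Monotone f := by
  intro x y hxy
  have key : ∀ s : Finset ι, f x ≤ f (s.piecewise y x) := by
    intro s
    induction s using Finset.induction_on with
    | empty => simp
    | insert i s hi ih =>
      refine ih.trans ?_
      rw [Finset.piecewise_insert]
      have h1 := hf i (s.piecewise y x) (hxy i)
      dsimp only at h1
      have h2 : update (s.piecewise y x) i (x i) = s.piecewise y x := by
        conv_rhs => rw [← update_eq_self i (s.piecewise y x)]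
        rw [Finset.piecewise_eq_of_notMem _ _ _ hi]
      rwa [h2] at h1
  simpa using key Finset.univ

variable [Fintype ι] [Fintype α]

/-- Resampling one coordinate of a product weight. -/
theorem sum_prod_mul_sum_update (w : ι → α → ℝ) (i : ι) (F : (ι → α) → ℝ) :
    ∑ x : ι → α, (∏ j, w j (x j)) * ∑ v, w i v * F (update x i v) =
      (∑ v, w i v) * ∑ x : ι → α, (∏ j, w j (x j)) * F x := by
  classical
  have hinv : ∀ q : (ι → α) × α,
      (update (update q.1 i q.2) i (q.1 i), (update q.1 i q.2) i) = q := by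
    rintro ⟨x, v⟩
    simp
  have e : ∑ x : ι → α, (∏ j, w j (x j)) * ∑ v, w i v * F (update x i v) =
      ∑ q : (ι → α) × α, ((∏ j, w j (q.1 j)) * w i q.2) * F (update q.1 i q.2) := by
    rw [Fintype.sum_prod_type]
    refine Finset.sum_congr rfl fun x _ => ?_
    rw [Finset.mul_sum]
    exact Finset.sum_congr rfl fun v _ => by ring
  rw [e]
  have e2 : ∑ q : (ι → α) × α, ((∏ j, w j (q.1 j)) * w i q.2) * F (update q.1 i q.2) =
      ∑ q : (ι → α) × α, ((∏ j, w j (q.1 j)) * w i q.2) * F q.1 := by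
    refine Finset.sum_nbij' (fun q => (update q.1 i q.2, q.1 i))
      (fun q => (update q.1 i q.2, q.1 i)) (by simp) (by simp) (fun q _ => ?_) (fun q _ => ?_)
      (fun q _ => ?_)
    · exact hinv q
    · exact hinv q
    · congr 1
      rw [← Finset.mul_prod_erase _ _ (Finset.mem_univ i),
        ← Finset.mul_prod_erase _ (fun j => w j (update q.1 i q.2 j)) (Finset.mem_univ i)]
      have : ∏ j ∈ Finset.univ.erase i, w j (update q.1 i q.2 j) =
          ∏ j ∈ Finset.univ.erase i, w j (q.1 j) :=
        Finset.prod_congr rfl fun j hj => by rw [update_of_ne (Finset.ne_of_mem_erase hj)]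
      simp only [this, update_self]
      ring
  rw [e2, Fintype.sum_prod_type, Finset.mul_sum]
  refine Finset.sum_congr rfl fun x _ => ?_
  dsimp only
  rw [← Finset.sum_mul, ← Finset.mul_sum]
  ring

/-- The `L_1`-distance with respect to a product weight. -/
def prodDistL1 (w : ι → α → ℝ) (f g : (ι → α) → ℝ) : ℝ :=
  ∑ x : ι → α, (∏ j, w j (x j)) * |f x - g x|

theorem prodDistL1_triangle {w : ι → α → ℝ} (hw : ∀ i v, 0 ≤ w i v) (f g h : (ι → α) → ℝ) :
    prodDistL1 w f h ≤ prodDistL1 w f g + prodDistL1 w g h := by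
  unfold prodDistL1
  rw [← Finset.sum_add_distrib]
  refine Finset.sum_le_sum fun x _ => ?_
  rw [← mul_add]
  exact mul_le_mul_of_nonneg_left (abs_sub_le _ _ _) (Finset.prod_nonneg fun j _ => hw j _)

theorem prodDistL1_comm (w : ι → α → ℝ) (f g : (ι → α) → ℝ) :
    prodDistL1 w f g = prodDistL1 w g f := by
  simp only [prodDistL1, abs_sub_comm]

/-- If `f` is close to functions that are monotone in one direction, for all directions, then it is
close to a monotone function: the case of positive weights. -/
theorem exists_monotone_prodDistL1_le_of_pos [Preorder α] [Nonempty α] {w : ι → α → ℝ}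
    (hw : ∀ i v, 0 < w i v)
    (f : (ι → α) → ℝ) (g : ι → (ι → α) → ℝ) (hg : ∀ i, DirMono i (g i)) :
    ∃ h : (ι → α) → ℝ, Monotone h ∧ prodDistL1 w f h ≤ 2 * ∑ i, prodDistL1 w f (g i) := by
  classical
  choose R hR hid hmono hmass using fun i => exists_isotonic_retraction (hw i)
  -- `S i` performs isotonic regression on every line in direction `i`.
  let S : ι → ((ι → α) → ℝ) → (ι → α) → ℝ := fun i f x => R i (fun v => f (update x i v)) (x i)
  have hSupd : ∀ i f x v, S i f (update x i v) = R i (fun v => f (update x i v)) v := by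
    intro i f x v
    simp [S]
  have hcontr : ∀ i f g, prodDistL1 w (S i f) (S i g) ≤ prodDistL1 w f g := by
    intro i f g
    have hW : 0 < ∑ v, w i v := Finset.sum_pos (fun v _ => hw i v) Finset.univ_nonempty
    refine le_of_mul_le_mul_left ?_ hW
    unfold prodDistL1
    rw [← sum_prod_mul_sum_update w i (fun x => |S i f x - S i g x|),
      ← sum_prod_mul_sum_update w i (fun x => |f x - g x|)]
    refine Finset.sum_le_sum fun x _ => mul_le_mul_of_nonneg_left ?_
      (Finset.prod_nonneg fun j _ => (hw j _).le)
    simp only [hSupd]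
    exact sum_abs_sub_le_of_monotone (hw i) (hmono i) (hmass i) _ _
  have hSi : ∀ i f, DirMono i (S i f) := by
    intro i f x
    simp only [hSupd]
    exact hR i _
  have hSid : ∀ i f, DirMono i f → S i f = f := by
    intro i f hf
    funext x
    simp only [S, hid i _ (hf x), update_eq_self]
  -- A step up in direction `j` compares the restrictions of `f` to two parallel lines, and `R i`
  -- preserves their order.
  have hSj : ∀ i j f, DirMono j f → DirMono j (S i f) := by
    intro i j f hf
    by_cases hij : i = j
    · subst hij; exact hSi i f
    · intro x u v huv
      simp only [S]
      rw [update_of_ne hij, update_of_ne hij]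
      refine hmono i ?_ (x i)
      intro z
      dsimp only
      rw [update_comm (Ne.symm hij), update_comm (Ne.symm hij)]
      exact hf _ huv
  -- The last clause drives the induction: repairing some directions leaves every direction as cheap
  -- to repair as it was for `f`.
  have key : ∀ s : Finset ι, ∃ h : (ι → α) → ℝ, (∀ i ∈ s, DirMono i h) ∧
      prodDistL1 w f h ≤ 2 * ∑ i ∈ s, prodDistL1 w f (g i) ∧
      ∀ j, ∃ g', DirMono j g' ∧ prodDistL1 w h g' ≤ prodDistL1 w f (g j) := by
    intro s
    induction s using Finset.induction_on with
    | empty => exact ⟨f, by simp, by simp [prodDistL1], fun j => ⟨g j, hg j, le_rfl⟩⟩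
    | insert i s hi ih =>
      obtain ⟨h, h1, h2, h3⟩ := ih
      refine ⟨S i h, fun j hj => ?_, ?_, fun j => ?_⟩
      · rcases Finset.mem_insert.mp hj with rfl | hj
        · exact hSi _ _
        · exact hSj _ _ _ (h1 j hj)
      · obtain ⟨g', hg', hd⟩ := h3 i
        -- The factor `2`: `g'` is fixed by `S i`, so both `h` and `S i h` are within the distance
        -- of `h` and `g'` from `g'`.
        have t1 := prodDistL1_triangle (fun i v => (hw i v).le) f h (S i h)
        have t2 := prodDistL1_triangle (fun i v => (hw i v).le) h g' (S i h)
        have t3 := hcontr i g' h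
        rw [hSid i g' hg', prodDistL1_comm w g' h] at t3
        rw [Finset.sum_insert hi]
        linarith
      · obtain ⟨g', hg', hd⟩ := h3 j
        exact ⟨S i g', hSj _ _ _ hg', (hcontr i _ _).trans hd⟩
  obtain ⟨h, h1, h2, -⟩ := key Finset.univ
  exact ⟨h, monotone_of_dirMono fun i => h1 i (Finset.mem_univ i), h2⟩

/-- Uniqueness of the regression needs positive weights. Adding a small `η` to all weights changes
the right side by at most `δ` and can only increase the left side. -/
theorem exists_monotone_prodDistL1_le [Preorder α] [Nonempty α] {w : ι → α → ℝ}
    (hw : ∀ i v, 0 ≤ w i v)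
    (f : (ι → α) → ℝ) (g : ι → (ι → α) → ℝ) (hg : ∀ i, DirMono i (g i)) {δ : ℝ} (hδ : 0 < δ) :
    ∃ h : (ι → α) → ℝ, Monotone h ∧ prodDistL1 w f h ≤ 2 * ∑ i, prodDistL1 w f (g i) + δ := by
  have hcont : Continuous fun η : ℝ => 2 * ∑ i, prodDistL1 (fun j v => w j v + η) f (g i) := by
    unfold prodDistL1
    fun_prop
  have hev : ∀ᶠ η in nhdsWithin (0 : ℝ) (Set.Ioi 0),
      2 * ∑ i, prodDistL1 (fun j v => w j v + η) f (g i) <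
        2 * ∑ i, prodDistL1 w f (g i) + δ := by
    refine (hcont.tendsto 0).mono_left nhdsWithin_le_nhds |>.eventually_lt_const ?_
    simpa using hδ
  obtain ⟨η, hη, hη0⟩ := (hev.and self_mem_nhdsWithin).exists
  have hη0 : 0 < η := hη0
  obtain ⟨h, hh, hle⟩ := exists_monotone_prodDistL1_le_of_pos
    (w := fun j v => w j v + η) (fun i v => by have := hw i v; linarith) f g hg
  refine ⟨h, hh, le_trans ?_ (hle.trans hη.le)⟩
  refine Finset.sum_le_sum fun x _ => mul_le_mul_of_nonneg_right ?_ (abs_nonneg _)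
  exact Finset.prod_le_prod (fun j _ => hw j _) fun j _ => by linarith

end Grid

open scoped Classical

/-! ### Boolean functions on a line: distance to monotone and detection of violations. -/

section Line

/-- Used twice: to quantize a function by its superlevel sets, and to count the rounds that take
enough samples. -/
theorem sum_range_ite_le_eq_floor {N : ℕ} {y : ℝ} (hy : y ≤ N) :
    ∑ s ∈ Finset.range N, (if (s : ℝ) + 1 ≤ y then (1 : ℝ) else 0) = (⌊y⌋₊ : ℝ) := by
  rw [← Finset.sum_filter]
  have : (Finset.range N).filter (fun s : ℕ => (s : ℝ) + 1 ≤ y) = Finset.range ⌊y⌋₊ := by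
    ext s
    simp only [Finset.mem_filter, Finset.mem_range]
    rw [← Nat.succ_le_iff (n := ⌊y⌋₊), Nat.le_floor_iff' (Nat.succ_ne_zero s)]
    push_cast
    refine ⟨fun h => h.2, fun h => ⟨?_, h⟩⟩
    have : ((s + 1 : ℕ) : ℝ) ≤ N := by push_cast; linarith
    exact_mod_cast this
  rw [this]
  simp

variable {n : ℕ}

/-- The weight of the points on which the predicate `one` differs from the monotone predicate
`z ≤ v`, minimized over `z`. -/
noncomputable def lineError (w : Fin n → ℝ) (one : Fin n → Prop) : ℝ :=
  (Finset.range (n + 1)).inf' ⟨0, by simp⟩ fun z =>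
    ∑ v : Fin n, if ((v : ℕ) < z ↔ one v) then w v else 0

theorem lineError_le_sum (w : Fin n → ℝ) (one : Fin n → Prop) {z : ℕ} (hz : z ≤ n) :
    lineError w one ≤ ∑ v : Fin n, if ((v : ℕ) < z ↔ one v) then w v else 0 :=
  Finset.inf'_le _ (by simpa [Nat.lt_succ_iff] using hz)

theorem exists_lineError_eq (w : Fin n → ℝ) (one : Fin n → Prop) :
    ∃ z, lineError w one = ∑ v : Fin n, if ((v : ℕ) < z ↔ one v) then w v else 0 := by
  obtain ⟨z, -, h⟩ := Finset.exists_mem_eq_inf' (s := Finset.range (n + 1)) ⟨0, by simp⟩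
    fun z => ∑ v : Fin n, if ((v : ℕ) < z ↔ one v) then w v else 0
  exact ⟨z, h⟩

theorem lineError_le_one {w : Fin n → ℝ} (hw : ∀ v, 0 ≤ w v) (hsum : ∑ v, w v = 1)
    (one : Fin n → Prop) : lineError w one ≤ 1 := by
  refine (lineError_le_sum w one (Nat.zero_le n)).trans ?_
  rw [← hsum]
  exact Finset.sum_le_sum fun v _ => by split_ifs <;> simp [hw v]

/-- A function on a line is approximated by the superposition of monotone approximations of its
level sets. -/
theorem exists_monotone_line_approx {w : Fin n → ℝ} (hw : ∀ v, 0 ≤ w v) (hsum : ∑ v, w v = 1)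
    {a b : ℝ} (hab : a < b) {h : Fin n → ℝ} (hh : ∀ v, h v ∈ Set.Icc a b) {N : ℕ} (hN : 0 < N) :
    ∃ g : Fin n → ℝ, Monotone g ∧ ∑ v, w v * |h v - g v| ≤ (b - a) / N *
      (1 + ∑ s ∈ Finset.range N,
        lineError w fun v => a + ((s : ℝ) + 1) * ((b - a) / N) ≤ h v) := by
  set r : ℝ := (b - a) / N with hr
  have hN' : (0 : ℝ) < N := by exact_mod_cast hN
  have hr0 : 0 < r := div_pos (by linarith) hN'
  choose z hz using fun s : ℕ => exists_lineError_eq w fun v => a + ((s : ℝ) + 1) * r ≤ h v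
  refine ⟨fun v => a + r * ∑ s ∈ Finset.range N, if z s ≤ (v : ℕ) then (1 : ℝ) else 0,
    fun u v huv => ?_, ?_⟩
  · dsimp only
    gcongr with s hs
    split_ifs with h1 h2
    · exact le_rfl
    · exact absurd (h1.trans huv) h2
    · exact zero_le_one
    · exact le_rfl
  -- Rounding `(h v - a) / r` down costs less than one unit of `r`; each threshold whose indicator
  -- disagrees with its monotone replacement costs one more.
  have hpt : ∀ v, |h v - (a + r * ∑ s ∈ Finset.range N, if z s ≤ (v : ℕ) then (1 : ℝ) else 0)| ≤
      r * (1 + ∑ s ∈ Finset.range N,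
        if ((v : ℕ) < z s ↔ a + ((s : ℝ) + 1) * r ≤ h v) then (1 : ℝ) else 0) := by
    intro v
    set y : ℝ := (h v - a) / r with hy
    have hyr : h v = a + r * y := by rw [hy]; field_simp; ring
    have hiff : ∀ s : ℕ, (a + ((s : ℝ) + 1) * r ≤ h v ↔ (s : ℝ) + 1 ≤ y) := by
      intro s
      rw [hy, le_div_iff₀ hr0]
      constructor <;> intro _ <;> linarith
    have hy0 : 0 ≤ y := div_nonneg (by linarith [(hh v).1]) hr0.le
    have hyN : y ≤ N := by
      rw [hy, div_le_iff₀ hr0, hr, mul_div_cancel₀ _ hN'.ne']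
      linarith [(hh v).2]
    have hc := sum_range_ite_le_eq_floor hyN
    have hfl := Nat.floor_le hy0
    have hfl' := Nat.lt_floor_add_one y
    have hdiff : |∑ s ∈ Finset.range N, (if (s : ℝ) + 1 ≤ y then (1 : ℝ) else 0) -
        ∑ s ∈ Finset.range N, if z s ≤ (v : ℕ) then (1 : ℝ) else 0| ≤
        ∑ s ∈ Finset.range N,
          if ((v : ℕ) < z s ↔ a + ((s : ℝ) + 1) * r ≤ h v) then (1 : ℝ) else 0 := by
      rw [← Finset.sum_sub_distrib]
      refine (Finset.abs_sum_le_sum_abs _ _).trans (Finset.sum_le_sum fun s _ => ?_)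
      simp only [hiff s]
      rcases le_or_gt (z s) (v : ℕ) with h2 | h2
      · by_cases h1 : (s : ℝ) + 1 ≤ y <;> simp [h1, h2, h2.not_gt]
      · by_cases h1 : (s : ℝ) + 1 ≤ y <;> simp [h1, h2, h2.not_ge]
    rw [hc] at hdiff
    have e : h v - (a + r * ∑ s ∈ Finset.range N, if z s ≤ (v : ℕ) then (1 : ℝ) else 0) =
        r * ((y - (⌊y⌋₊ : ℝ)) + ((⌊y⌋₊ : ℝ) -
          ∑ s ∈ Finset.range N, if z s ≤ (v : ℕ) then (1 : ℝ) else 0)) := by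
      rw [hyr]; ring
    rw [e, abs_mul, abs_of_pos hr0]
    refine mul_le_mul_of_nonneg_left ((abs_add_le _ _).trans (add_le_add ?_ hdiff)) hr0.le
    rw [abs_le]
    constructor <;> linarith
  calc _ ≤ ∑ v, w v * (r * (1 + ∑ s ∈ Finset.range N,
        if ((v : ℕ) < z s ↔ a + ((s : ℝ) + 1) * r ≤ h v) then (1 : ℝ) else 0)) :=
        Finset.sum_le_sum fun v _ => mul_le_mul_of_nonneg_left (hpt v) (hw v)
    _ = r * (∑ v, w v + ∑ v : Fin n, ∑ s ∈ Finset.range N,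
        if ((v : ℕ) < z s ↔ a + ((s : ℝ) + 1) * r ≤ h v) then w v else 0) := by
        rw [← Finset.sum_add_distrib, Finset.mul_sum]
        refine Finset.sum_congr rfl fun v _ => ?_
        have : ∑ s ∈ Finset.range N, (if ((v : ℕ) < z s ↔ a + ((s : ℝ) + 1) * r ≤ h v)
            then w v else 0) = w v * ∑ s ∈ Finset.range N,
            (if ((v : ℕ) < z s ↔ a + ((s : ℝ) + 1) * r ≤ h v) then (1 : ℝ) else 0) := by
          rw [Finset.mul_sum]
          exact Finset.sum_congr rfl fun s _ => by split_ifs <;> simp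
        rw [this]
        ring
    _ = _ := by
        rw [Finset.sum_comm, hsum]
        congr 2
        exact Finset.sum_congr rfl fun s _ => (hz s).symm

/-- A predicate that is far from monotone has many witnesses on both sides of some point. -/
theorem exists_separating_point {w : Fin n → ℝ} {one : Fin n → Prop} {x : ℝ}
    (hx0 : 0 < x) (hx : x ≤ lineError w one) :
    ∃ z : ℕ, x / 2 ≤ ∑ v : Fin n, (if (v : ℕ) ≤ z ∧ one v then w v else 0) ∧
      x / 2 ≤ ∑ v : Fin n, if z < (v : ℕ) ∧ ¬ one v then w v else 0 := by
  have hex : ∃ z : ℕ, x / 2 ≤ ∑ v : Fin n, (if (v : ℕ) ≤ z ∧ one v then w v else 0) := by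
    refine ⟨n, ?_⟩
    have h1 := hx.trans (lineError_le_sum w one le_rfl)
    have h2 : ∑ v : Fin n, (if ((v : ℕ) < n ↔ one v) then w v else 0) =
        ∑ v : Fin n, if (v : ℕ) ≤ n ∧ one v then w v else 0 :=
      Finset.sum_congr rfl fun v _ => by simp [v.2, v.2.le]
    linarith
  -- By minimality of `z` the members strictly below `z` weigh less than `x / 2`, and `z` is itself
  -- a member. The errors of the up-set `z ≤ v` weigh at least `x`, so the rest of them are
  -- non-members strictly beyond `z`.
  refine ⟨Nat.find hex, Nat.find_spec hex, ?_⟩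
  set z := Nat.find hex with hz
  have hlt : ∑ v : Fin n, (if (v : ℕ) < z ∧ one v then w v else 0) < x / 2 := by
    rcases Nat.eq_zero_or_pos z with h0 | hpos
    · rw [h0]; simp [hx0]
    · have := Nat.find_min hex (m := z - 1) (by omega)
      push Not at this
      refine lt_of_eq_of_lt (Finset.sum_congr rfl fun v _ => ?_) this
      have : (v : ℕ) < z ↔ (v : ℕ) ≤ z - 1 := by omega
      simp only [this]
  have hzn : z ≤ n := by
    by_contra hcon
    push Not at hcon
    have hspec := Nat.find_min hex hcon
    apply hspec
    have h3 := Nat.find_spec hex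
    refine h3.trans_eq (Finset.sum_congr rfl fun v _ => ?_)
    have h4 := v.2
    have : (v : ℕ) ≤ Nat.find hex ↔ (v : ℕ) ≤ n := by omega
    simp only [this]
  have hone : ∃ v : Fin n, (v : ℕ) = z ∧ one v := by
    by_contra hcon
    push Not at hcon
    have h3 := Nat.find_spec hex
    refine absurd (h3.trans_eq (Finset.sum_congr rfl fun v _ => ?_)) (not_le.mpr hlt)
    have : ((v : ℕ) ≤ Nat.find hex ∧ one v) ↔ ((v : ℕ) < z ∧ one v) :=
      ⟨fun h => ⟨lt_of_le_of_ne h.1 fun e => hcon v e h.2, h.2⟩, fun h => ⟨h.1.le, h.2⟩⟩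
    simp only [this]
  obtain ⟨v0, hv0, hone0⟩ := hone
  have h1 := hx.trans (lineError_le_sum w one hzn)
  have h2 : ∑ v : Fin n, (if ((v : ℕ) < z ↔ one v) then w v else 0) =
      ∑ v : Fin n, (if (v : ℕ) < z ∧ one v then w v else 0) +
        ∑ v : Fin n, if z < (v : ℕ) ∧ ¬ one v then w v else 0 := by
    rw [← Finset.sum_add_distrib]
    refine Finset.sum_congr rfl fun v _ => ?_
    rcases lt_trichotomy (v : ℕ) z with h | h | h
    · by_cases ho : one v <;> simp [h, ho, h.not_gt]
    · have : v = v0 := Fin.ext (h.trans hv0.symm)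
      subst this
      simp [h, hone0]
    · by_cases ho : one v <;> simp [h, ho, h.not_gt]
  linarith

/-- The probability that `k` samples push the least seen position `lo` of a point that satisfies `one`
below the greatest seen position `hi` of a point that does not. -/
noncomputable def detectProb (w : Fin n → ℝ) (one : Fin n → Prop) : ℕ → ℕ → ℕ → ℝ
  | 0, lo, hi => if lo < hi then 1 else 0
  | k + 1, lo, hi => ∑ v : Fin n, w v * if one v then detectProb w one k (min lo v) hi
      else detectProb w one k lo (max hi v)

theorem detectProb_mem_Icc {w : Fin n → ℝ} (hw : ∀ v, 0 ≤ w v) (hsum : ∑ v, w v = 1)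
    (one : Fin n → Prop) (k lo hi : ℕ) : detectProb w one k lo hi ∈ Set.Icc (0 : ℝ) 1 := by
  induction k generalizing lo hi with
  | zero => unfold detectProb; split_ifs <;> simp
  | succ k ih =>
    unfold detectProb
    have hmem : ∀ v : Fin n, (if one v then detectProb w one k (min lo v) hi
        else detectProb w one k lo (max hi v)) ∈ Set.Icc (0 : ℝ) 1 := fun v => by
      split_ifs <;> exact ih _ _
    refine ⟨Finset.sum_nonneg fun v _ => mul_nonneg (hw v) (hmem v).1, ?_⟩
    rw [← hsum]
    exact Finset.sum_le_sum fun v _ => mul_le_of_le_one_right (hw v) (hmem v).2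

/-- For an up-set the samples preserve the invariant that `hi` is below all members and `lo` is
above all non-members. -/
theorem detectProb_eq_zero (w : Fin n → ℝ) {one : Fin n → Prop}
    (hone : ∀ u v, one u → ¬ one v → v ≤ u) (k : ℕ) {lo hi : ℕ} (hle : hi ≤ lo)
    (hhi : ∀ v, one v → hi ≤ (v : ℕ)) (hlo : ∀ v, ¬ one v → (v : ℕ) ≤ lo) :
    detectProb w one k lo hi = 0 := by
  induction k generalizing lo hi with
  | zero => simp [detectProb, hle.not_gt]
  | succ k ih =>
    unfold detectProb
    refine Finset.sum_eq_zero fun v _ => mul_eq_zero_of_right _ ?_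
    split_ifs with hv
    · exact ih (le_min hle (hhi v hv)) hhi fun u hu => le_min (hlo u hu) (hone v u hv hu)
    · exact ih (max_le hle (hlo v hv)) (fun u hu => max_le (hhi u hu) (hone u v hu hv)) hlo

/-- A union bound: once `lo ≤ z < hi` a violation is seen, so failure means that all samples missed
the members up to `z` or all missed the non-members beyond `z`. A side that is already on the right
side of `z` contributes nothing. -/
theorem le_detectProb {w : Fin n → ℝ} (hw : ∀ v, 0 ≤ w v) (hsum : ∑ v, w v = 1)
    (one : Fin n → Prop) (z k lo hi : ℕ) :
    1 - (if z < lo then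
        (1 - ∑ v : Fin n, if (v : ℕ) ≤ z ∧ one v then w v else 0) ^ k else 0) -
      (if hi ≤ z then
        (1 - ∑ v : Fin n, if z < (v : ℕ) ∧ ¬ one v then w v else 0) ^ k else 0) ≤
      detectProb w one k lo hi := by
  induction k generalizing lo hi with
  | zero =>
    unfold detectProb
    by_cases h1 : z < lo <;> by_cases h2 : hi ≤ z <;> by_cases h3 : lo < hi <;>
      simp [h1, h2, h3]
    omega
  | succ k ih =>
    set A := ∑ v : Fin n, if (v : ℕ) ≤ z ∧ one v then w v else 0 with hA
    set B := ∑ v : Fin n, if z < (v : ℕ) ∧ ¬ one v then w v else 0 with hB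
    have hA1 : 0 ≤ 1 - A := by
      rw [← hsum, sub_nonneg]
      exact Finset.sum_le_sum fun v _ => by split_ifs <;> simp [hw v]
    have hB1 : 0 ≤ 1 - B := by
      rw [← hsum, sub_nonneg]
      exact Finset.sum_le_sum fun v _ => by split_ifs <;> simp [hw v]
    set P : ℝ := if z < lo then (1 - A) ^ k else 0 with hP
    set Q : ℝ := if hi ≤ z then (1 - B) ^ k else 0 with hQ
    have hP0 : 0 ≤ P := by rw [hP]; split_ifs <;> positivity
    have hQ0 : 0 ≤ Q := by rw [hQ]; split_ifs <;> positivity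
    have e1 : (if z < lo then (1 - A) ^ (k + 1) else 0) = P * (1 - A) := by
      rw [hP]; split_ifs <;> ring
    have e2 : (if hi ≤ z then (1 - B) ^ (k + 1) else 0) = Q * (1 - B) := by
      rw [hQ]; split_ifs <;> ring
    rw [e1, e2]
    unfold detectProb
    have e3 : 1 - P * (1 - A) - Q * (1 - B) = ∑ v : Fin n, w v *
        (1 - P * (1 - if (v : ℕ) ≤ z ∧ one v then 1 else 0) -
          Q * (1 - if z < (v : ℕ) ∧ ¬ one v then 1 else 0)) := by
      have : ∀ v : Fin n, w v * (1 - P * (1 - if (v : ℕ) ≤ z ∧ one v then 1 else 0) -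
          Q * (1 - if z < (v : ℕ) ∧ ¬ one v then 1 else 0)) =
          w v * (1 - P - Q) + P * (if (v : ℕ) ≤ z ∧ one v then w v else 0) +
            Q * (if z < (v : ℕ) ∧ ¬ one v then w v else 0) := fun v => by
        split_ifs <;> ring
      simp only [this]
      rw [Finset.sum_add_distrib, Finset.sum_add_distrib, ← Finset.sum_mul, ← Finset.mul_sum,
        ← Finset.mul_sum, hsum, ← hA, ← hB]
      ring
    rw [e3]
    refine Finset.sum_le_sum fun v _ => mul_le_mul_of_nonneg_left ?_ (hw v)
    by_cases ho : one v
    · rw [if_pos ho]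
      refine le_trans ?_ (ih _ _)
      rw [← hQ]
      by_cases h1 : (v : ℕ) ≤ z
      · have : ¬ z < min lo (v : ℕ) := by omega
        simp [h1, ho, this]
      · have : z < min lo (v : ℕ) ↔ z < lo := by omega
        simp only [this, ← hP]
        simp [h1, ho]
    · rw [if_neg ho]
      refine le_trans ?_ (ih _ _)
      rw [← hP]
      by_cases h1 : z < (v : ℕ)
      · have : ¬ max hi (v : ℕ) ≤ z := by omega
        simp [h1, ho, this]
      · have : max hi (v : ℕ) ≤ z ↔ hi ≤ z := by omega
        simp only [this, ← hQ]
        simp [h1, ho]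

/-- If `one` is at distance `x` from monotone, then `4 / x` samples find a violation with
probability `1 / 2`. -/
theorem half_le_detectProb {w : Fin n → ℝ} (hw : ∀ v, 0 ≤ w v) (hsum : ∑ v, w v = 1)
    {one : Fin n → Prop} {x : ℝ} (hx0 : 0 < x) (hx : x ≤ lineError w one) {k : ℕ}
    (hk : 4 ≤ x * k) (lo hi : ℕ) : 1 / 2 ≤ detectProb w one k lo hi := by
  obtain ⟨z, hA, hB⟩ := exists_separating_point hx0 hx
  have hle := le_detectProb hw hsum one z k lo hi
  -- Each side fails with probability at most `exp (-x * k / 2) ≤ exp (-2) ≤ 1 / 4`.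
  have hpow : ∀ A : ℝ, A ≤ 1 → x / 2 ≤ A → (1 - A) ^ k ≤ 1 / 4 := by
    intro A hA1 hA
    have h1 : (1 - A) ^ k ≤ Real.exp (-2) := by
      calc (1 - A) ^ k ≤ (Real.exp (-A)) ^ k :=
            pow_le_pow_left₀ (by linarith) (by linarith [Real.add_one_le_exp (-A)]) k
        _ = Real.exp (-(k * A)) := by rw [← Real.exp_nat_mul]; ring_nf
        _ ≤ Real.exp (-2) := Real.exp_le_exp.mpr (by
            have : (k : ℝ) * (x / 2) ≤ k * A := mul_le_mul_of_nonneg_left hA (Nat.cast_nonneg k)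
            linarith)
    refine h1.trans ?_
    rw [Real.exp_neg, inv_eq_one_div]
    refine one_div_le_one_div_of_le (by norm_num) ?_
    have h2 : (2 : ℝ) ≤ Real.exp 1 := by linarith [Real.add_one_le_exp (1 : ℝ)]
    have h3 : Real.exp 2 = Real.exp 1 * Real.exp 1 := by rw [← Real.exp_add]; norm_num
    nlinarith
  have hAle : ∑ v : Fin n, (if (v : ℕ) ≤ z ∧ one v then w v else 0) ≤ 1 := by
    rw [← hsum]
    exact Finset.sum_le_sum fun v _ => by split_ifs <;> simp [hw v]
  have hBle : ∑ v : Fin n, (if z < (v : ℕ) ∧ ¬ one v then w v else 0) ≤ 1 := by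
    rw [← hsum]
    exact Finset.sum_le_sum fun v _ => by split_ifs <;> simp [hw v]
  have h1 := hpow _ hAle hA
  have h2 := hpow _ hBle hB
  refine le_trans ?_ hle
  split_ifs <;> linarith

end Line

/-! ### Lower bounds for halting probabilities of programs. -/

noncomputable section Machine

variable {n d : ℕ} (μ : PMF (Fin d → Fin n)) (f : (Fin d → Fin n) → ℝ) (A : Set (Memory n d))

/-- The probability that the machine halts within `T` steps with its memory in `A`. -/
def value (T : ℕ) (s : Config n d) : ℝ :=
  ((run μ f T s).toOuterMeasure {s | s.1 = [] ∧ s.2 ∈ A}).toReal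

/-- The expectation of `Φ` after an elementary operation. -/
def opExp (Φ : Memory n d → ℝ) (m : Memory n d) : Op → ℝ
  | .natConst r k => Φ (m.setNat r k)
  | .natAdd r s t => Φ (m.setNat r (m.nat s + m.nat t))
  | .natSub r s t => Φ (m.setNat r (m.nat s - m.nat t))
  | .natMul r s t => Φ (m.setNat r (m.nat s * m.nat t))
  | .natLoad r s => Φ (m.setNat r (m.nat (m.nat s)))
  | .natStore r s => Φ (m.setNat (m.nat r) (m.nat s))
  | .cast r s => Φ (m.setReal r (m.nat s : ℝ))
  | .realAdd r s t => Φ (m.setReal r (m.real s + m.real t))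
  | .realSub r s t => Φ (m.setReal r (m.real s - m.real t))
  | .realMul r s t => Φ (m.setReal r (m.real s * m.real t))
  | .realDiv r s t => Φ (m.setReal r (m.real s / m.real t))
  | .realLoad r s => Φ (m.setReal r (m.real (m.nat s)))
  | .realStore r s => Φ (m.setReal (m.nat r) (m.real s))
  | .rand r s => if m.nat s = 0 then Φ (m.setNat r 0) else
      (∑ j ∈ Finset.range (m.nat s), Φ (m.setNat r j)) / m.nat s
  | .sample q => ∑ x, (μ x).toReal * Φ (m.setPt q x)
  | .getCoord r q i => Φ (m.setNat r (coord (m.pt q) (m.nat i)))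
  | .setCoord q i r => Φ (m.setPt q (replaceCoord (m.pt q) (m.nat i) (m.nat r)))
  | .query r q => Φ (m.setReal r (f (m.pt q)))

theorem opExp_mono {Φ Ψ : Memory n d → ℝ} (h : ∀ m, Φ m ≤ Ψ m) (m : Memory n d) (o : Op) :
    opExp μ f Φ m o ≤ opExp μ f Ψ m o := by
  cases o with
  | rand r s =>
    simp only [opExp]
    split_ifs
    · exact h _
    · gcongr
      exact h _
  | sample q =>
    simp only [opExp]
    gcongr
    exact h _
  | _ => exact h _

theorem toOuterMeasure_le_one {β : Type*} (p : PMF β) (s : Set β) : p.toOuterMeasure s ≤ 1 := by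
  rw [← (p.toOuterMeasure_apply_eq_one_iff (s := Set.univ)).mpr (Set.subset_univ _)]
  exact p.toOuterMeasure.mono (Set.subset_univ _)

theorem toOuterMeasure_ne_top {β : Type*} (p : PMF β) (s : Set β) : p.toOuterMeasure s ≠ ⊤ :=
  ((toOuterMeasure_le_one p s).trans_lt ENNReal.one_lt_top).ne

theorem toOuterMeasure_run_succ (S : Set (Config n d)) (T : ℕ) (s : Config n d) :
    (run μ f (T + 1) s).toOuterMeasure S =
      ∑' s', step μ f s s' * (run μ f T s').toOuterMeasure S := by
  rw [run, PMF.toOuterMeasure_bind_apply]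

theorem run_nil (T : ℕ) (m : Memory n d) : run μ f T ([], m) = PMF.pure ([], m) := by
  induction T with
  | zero => rfl
  | succ T ih => rw [run, step, PMF.pure_bind, ih]

theorem value_nil (T : ℕ) (m : Memory n d) :
    value μ f A T ([], m) = if m ∈ A then 1 else 0 := by
  rw [value, run_nil, PMF.toOuterMeasure_pure_apply]
  by_cases h : m ∈ A <;> simp [h]

/-- Halted configurations are absorbing. Hence time bounds may be rounded up, and branches of
different lengths share one bound. -/
theorem value_mono_succ (T : ℕ) (s : Config n d) :
    value μ f A T s ≤ value μ f A (T + 1) s := by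
  refine ENNReal.toReal_mono (toOuterMeasure_ne_top _ _) ?_
  induction T generalizing s with
  | zero =>
    rcases s with ⟨_ | ⟨c, k⟩, m⟩
    · rw [run_nil, run_nil]
    · rw [run, PMF.toOuterMeasure_pure_apply]
      simp
  | succ T ih =>
    rw [toOuterMeasure_run_succ, toOuterMeasure_run_succ]
    exact ENNReal.tsum_le_tsum fun s' => mul_le_mul_right (ih s') _

theorem value_mono {T T' : ℕ} (h : T ≤ T') (s : Config n d) :
    value μ f A T s ≤ value μ f A T' s :=
  monotone_nat_of_le_succ (fun T => value_mono_succ μ f A T s) h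

theorem value_of_step_eq_pure {s s' : Config n d} (h : step μ f s = PMF.pure s') (T : ℕ) :
    value μ f A (T + 1) s = value μ f A T s' := by
  rw [value, run, h, PMF.pure_bind, value]

theorem value_of_step_eq_map {β : Type*} {s : Config n d} {p : PMF β} {g : β → Config n d}
    (h : step μ f s = p.map g) (T : ℕ) (t : Finset β) (ht : ∀ x ∉ t, p x = 0) :
    value μ f A (T + 1) s = ∑ x ∈ t, (p x).toReal * value μ f A T (g x) := by
  rw [value, run, h, PMF.bind_map, PMF.toOuterMeasure_bind_apply, tsum_eq_sum (s := t),
    ENNReal.toReal_sum]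
  · exact Finset.sum_congr rfl fun x _ => by rw [ENNReal.toReal_mul]; rfl
  · exact fun x _ => ENNReal.mul_ne_top (PMF.apply_ne_top _ _) (toOuterMeasure_ne_top _ _)
  · intro x hx
    rw [ht x hx, zero_mul]

theorem value_op (T : ℕ) (o : Op) (k : List Prog) (m : Memory n d) :
    value μ f A (T + 1) (.op o :: k, m) = opExp μ f (fun m' => value μ f A T (k, m')) m o := by
  cases o with
  | rand r s =>
    have hs : step μ f (.op (.rand r s) :: k, m) =
        (uniformBelow (m.nat s)).map fun j => (k, m.setNat r j) := by
      rw [step, Op.exec, PMF.map_comp]; rfl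
    simp only [opExp]
    by_cases h0 : m.nat s = 0
    · rw [if_pos h0]
      refine value_of_step_eq_pure μ f A ?_ T
      rw [hs, uniformBelow, dif_pos h0, PMF.pure_map]
    · rw [if_neg h0]
      have hp : ∀ j, uniformBelow (m.nat s) j =
          if j ∈ Finset.range (m.nat s) then ((m.nat s : ENNReal))⁻¹ else 0 := by
        intro j
        rw [uniformBelow, dif_neg h0, PMF.uniformOfFinset_apply, Finset.card_range]
        congr
      rw [value_of_step_eq_map μ f A hs T (Finset.range (m.nat s))
        (fun j hj => by rw [hp, if_neg hj]), Finset.sum_div]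
      refine Finset.sum_congr rfl fun j hj => ?_
      rw [hp, if_pos hj, ENNReal.toReal_inv, ENNReal.toReal_natCast]
      ring
  | sample q =>
    have hs : step μ f (.op (.sample q) :: k, m) = μ.map fun x => (k, m.setPt q x) := by
      rw [step, Op.exec, PMF.map_comp]; rfl
    rw [value_of_step_eq_map μ f A hs T Finset.univ (by simp)]
    rfl
  | _ =>
    refine value_of_step_eq_pure μ f A ?_ T
    rw [step, Op.exec, PMF.pure_map]

theorem value_seq (T : ℕ) (c₁ c₂ : Prog) (k : List Prog) (m : Memory n d) :
    value μ f A (T + 1) (.seq c₁ c₂ :: k, m) = value μ f A T (c₁ :: c₂ :: k, m) :=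
  value_of_step_eq_pure μ f A rfl T

theorem value_cond (T : ℕ) (t : Test) (c₁ c₂ : Prog) (k : List Prog) (m : Memory n d) :
    value μ f A (T + 1) (.cond t c₁ c₂ :: k, m) =
      value μ f A T ((if t.Holds m then c₁ else c₂) :: k, m) :=
  value_of_step_eq_pure μ f A rfl T

theorem value_loop_of_holds (T : ℕ) {t : Test} (c : Prog) (k : List Prog) {m : Memory n d}
    (h : t.Holds m) :
    value μ f A (T + 1) (.loop t c :: k, m) = value μ f A T (c :: .loop t c :: k, m) :=
  value_of_step_eq_pure μ f A (by rw [step, if_pos h]) T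

theorem value_loop_of_not_holds (T : ℕ) {t : Test} (c : Prog) (k : List Prog) {m : Memory n d}
    (h : ¬ t.Holds m) :
    value μ f A (T + 1) (.loop t c :: k, m) = value μ f A T (k, m) :=
  value_of_step_eq_pure μ f A (by rw [step, if_neg h]) T

/-- Programs without loops. -/
def LoopFree : Prog → Prop
  | .op _ => True
  | .seq c₁ c₂ => LoopFree c₁ ∧ LoopFree c₂
  | .cond _ c₁ c₂ => LoopFree c₁ ∧ LoopFree c₂
  | .loop _ _ => False

/-- A bound for the running time of a program without loops. -/
def loopFreeTime : Prog → ℕ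
  | .op _ => 1
  | .seq c₁ c₂ => loopFreeTime c₁ + loopFreeTime c₂ + 1
  | .cond _ c₁ c₂ => max (loopFreeTime c₁) (loopFreeTime c₂) + 1
  | .loop _ _ => 0

/-- The expectation of `Φ` after a program without loops. -/
def progExp : Prog → (Memory n d → ℝ) → Memory n d → ℝ
  | .op o, Φ, m => opExp μ f Φ m o
  | .seq c₁ c₂, Φ, m => progExp c₁ (progExp c₂ Φ) m
  | .cond t c₁ c₂, Φ, m => if t.Holds m then progExp c₁ Φ m else progExp c₂ Φ m
  | .loop _ _, _, _ => 0

/-- A weakest-precondition rule: a lower bound for the continuation is pulled back through loop-free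
code, and the time bounds add up. -/
theorem progExp_le_value {c : Prog} (hc : LoopFree c) {Φ : Memory n d → ℝ} {T : ℕ}
    {k : List Prog} (hΦ : ∀ m, Φ m ≤ value μ f A T (k, m)) (m : Memory n d) :
    progExp μ f c Φ m ≤ value μ f A (T + loopFreeTime c) (c :: k, m) := by
  induction c generalizing Φ T k m with
  | op o =>
    rw [loopFreeTime, value_op]
    exact opExp_mono μ f hΦ m o
  | seq c₁ c₂ h₁ h₂ =>
    have e : T + loopFreeTime (.seq c₁ c₂) = T + loopFreeTime c₂ + loopFreeTime c₁ + 1 := by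
      rw [loopFreeTime]; ring
    rw [e, value_seq, progExp]
    exact h₁ hc.1 (h₂ hc.2 hΦ) m
  | cond t c₁ c₂ h₁ h₂ =>
    rw [loopFreeTime, ← add_assoc, value_cond, progExp]
    split_ifs
    · exact (h₁ hc.1 hΦ m).trans (value_mono μ f A (by gcongr; exact le_max_left _ _) _)
    · exact (h₂ hc.2 hΦ m).trans (value_mono μ f A (by gcongr; exact le_max_right _ _) _)
  | loop t c _ => exact hc.elim

/-- The elementary operations of a list, followed by a program. -/
def seqOps : List Op → Prog → Prog
  | [], c => c
  | o :: l, c => .seq (.op o) (seqOps l c)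

end Machine

/-! ### The program and its loop invariants. -/

noncomputable section Tester

/-- Takes a sample on the current line and updates the least position of a value that is at least the
threshold and the greatest position of a value below it. -/
def sampleProg : Prog :=
  -- Natural cells: 0 verdict, 3 number of rounds, 4 current round, 5 sampling counter, 6 and 7 the
  -- extremal positions `lo` and `hi`, 8 direction, 9 sampled coordinate, 10 the constant one, 11
  -- threshold index, 12 the constant zero. Real cells: 6 threshold, 7 queried value, 8 threshold
  -- spacing. The counter grows by the round number up to `N`, which yields `⌈N / (j + 1)⌉` samples
  -- without a division. Setting cell 12 to zero serves as a no-op.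
  seqOps [.sample 1, .getCoord 9 1 8, .setCoord 0 8 9, .query 7 0, .natAdd 5 5 4]
    (.cond (.realLt 7 6)
      (.cond (.natLt 7 9) (.op (.natAdd 7 9 12)) (.op (.natConst 12 0)))
      (.cond (.natLt 9 6) (.op (.natAdd 6 9 12)) (.op (.natConst 12 0))))

/-- Chooses a random axis-parallel line and a random threshold. -/
def lineProg : Prog :=
  -- The initial values `lo = n` and `hi = 0` mean that nothing has been seen; neither can cause a
  -- false rejection.
  seqOps [.natAdd 4 4 10, .rand 8 2, .rand 11 3, .natAdd 11 11 10, .cast 6 11, .realMul 6 6 8,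
    .realAdd 6 1 6, .sample 0, .natConst 5 0, .natAdd 6 1 12] (.op (.natConst 7 0))

/-- Rejects if a violation of monotonicity has been seen. -/
def verdictProg : Prog :=
  .cond (.natLt 6 7) (.op (.natConst 0 0)) (.op (.natConst 12 0))

/-- One round of the tester. -/
def roundProg : Prog :=
  .seq lineProg (.seq (.loop (.natLt 5 3) sampleProg) verdictProg)

/-- Computes the real number `64 d / ε ^ p`. -/
def targetProg (p : ℕ) : Prog :=
  -- Real cell 4 temporarily holds one, so `ε` is multiplied by one if `p = 1` and by itself
  -- otherwise.
  seqOps [.natConst 10 1, .cast 4 10, .realMul 3 0 (if p = 1 then 4 else 0), .natConst 5 64,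
    .natMul 5 5 2, .cast 5 5, .realDiv 3 5 3] (.op (.cast 4 3))

/-- Increments the number of rounds. -/
def countProg : Prog :=
  seqOps [.natAdd 3 3 10] (.op (.cast 4 3))

/-- Computes the distance of the thresholds and sets the verdict to accept. -/
def setupProg : Prog :=
  seqOps [.realSub 8 2 1, .realDiv 8 8 4] (.op (.natConst 0 1))

/-- The tester. -/
def tester (p : ℕ) : Prog :=
  .seq (targetProg p) (.seq (.loop (.realLt 4 3) countProg)
    (.seq setupProg (.loop (.natLt 4 3) roundProg)))

variable {n d : ℕ}

/-- The memory while samples are taken on a line in direction `i` through `x`. -/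
structure LineState (N j flag : ℕ) (a r θ : ℝ) (i : Fin d) (x : Fin d → Fin n)
    (m : Memory n d) : Prop where
  nat_zero : m.nat 0 = flag
  nat_one : m.nat 1 = n
  nat_two : m.nat 2 = d
  nat_three : m.nat 3 = N
  nat_four : m.nat 4 = j
  nat_eight : m.nat 8 = i
  nat_ten : m.nat 10 = 1
  nat_twelve : m.nat 12 = 0
  real_one : m.real 1 = a
  real_six : m.real 6 = θ
  real_eight : m.real 8 = r
  -- Coordinate `i` of the stored point is overwritten by the samples; only the line through it
  -- stays fixed.
  pt_zero : ∀ v, update (m.pt 0) i v = update x i v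

/-- The memory after `j` of `N` rounds. -/
structure RoundState (N j flag : ℕ) (a r : ℝ) (m : Memory n d) : Prop where
  nat_zero : m.nat 0 = flag
  nat_one : m.nat 1 = n
  nat_two : m.nat 2 = d
  nat_three : m.nat 3 = N
  nat_four : m.nat 4 = j
  nat_ten : m.nat 10 = 1
  nat_twelve : m.nat 12 = 0
  real_one : m.real 1 = a
  real_eight : m.real 8 = r

theorem LineState.roundState {N j flag : ℕ} {a r θ : ℝ} {i : Fin d} {x : Fin d → Fin n}
    {m : Memory n d} (h : LineState N j flag a r θ i x m) : RoundState N j flag a r m :=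
  ⟨h.1, h.2, h.3, h.4, h.5, h.7, h.8, h.9, h.11⟩

theorem coord_val (x : Fin d → Fin n) (i : Fin d) : coord x i = x i := by
  simp [coord]

theorem replaceCoord_val (x : Fin d → Fin n) (i : Fin d) (v : Fin n) :
    replaceCoord x i v = update x i v := by
  simp [replaceCoord]

theorem prodDist_toReal (D : Fin d → PMF (Fin n)) (x : Fin d → Fin n) :
    (prodDist D x).toReal = ∏ i, (D i (x i)).toReal := by
  rw [prodDist, PMF.ofFintype_apply, ENNReal.toReal_prod]

theorem sum_toReal_eq_one (q : PMF (Fin n)) : ∑ v, (q v).toReal = 1 := by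
  rw [← ENNReal.toReal_sum fun v _ => q.apply_ne_top v]
  have := q.tsum_coe
  rw [tsum_fintype] at this
  rw [this, ENNReal.toReal_one]

theorem sum_prodDist_toReal (D : Fin d → PMF (Fin n)) : ∑ x, (prodDist D x).toReal = 1 := by
  simp only [prodDist_toReal]
  have h := Finset.prod_univ_sum (fun _ : Fin d => (Finset.univ : Finset (Fin n)))
    (fun i j => (D i j).toReal)
  rw [Fintype.piFinset_univ] at h
  rw [← h]
  exact Finset.prod_eq_one fun i _ => sum_toReal_eq_one _

theorem sum_prodDist_marginal (D : Fin d → PMF (Fin n)) (i : Fin d) (F : Fin n → ℝ) :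
    ∑ x, (prodDist D x).toReal * F (x i) = ∑ v, (D i v).toReal * F v := by
  have h := sum_prod_mul_sum_update (fun i v => (D i v).toReal) i (fun x => F (x i))
  simp only [update_self, sum_toReal_eq_one, one_mul, ← prodDist_toReal] at h
  rw [← h, ← Finset.sum_mul, sum_prodDist_toReal, one_mul]

variable (D : Fin d → PMF (Fin n)) (f : (Fin d → Fin n) → ℝ) (A : Set (Memory n d))

/-- The probability that `k` samples on the line in direction `i` through `x` reveal that the
indicator of `θ ≤ f` is not monotone. -/
def lineDetectProb (k : ℕ) (θ : ℝ) (i : Fin d) (x : Fin d → Fin n) : ℕ → ℕ → ℝ :=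
  detectProb (fun v => (D i v).toReal) (fun v => θ ≤ f (update x i v)) k

/-- Only coordinate `i` of the fresh sample is used, and its law is the marginal `D i`; this is one
step of the recursion of `detectProb`. -/
theorem le_progExp_sampleProg {N j flag : ℕ} {a r θ : ℝ} {i : Fin d} {x : Fin d → Fin n}
    {m : Memory n d} (hm : LineState N j flag a r θ i x m) {Φ : Memory n d → ℝ} {G : ℕ → ℕ → ℝ}
    (hΦ : ∀ m', LineState N j flag a r θ i x m' → m'.nat 5 = m.nat 5 + j →
      G (m'.nat 6) (m'.nat 7) ≤ Φ m') :
    ∑ v, (D i v).toReal * (if θ ≤ f (update x i v) then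
        G (min (m.nat 6) v) (m.nat 7) else G (m.nat 6) (max (m.nat 7) v)) ≤
      progExp (prodDist D) f sampleProg Φ m := by
  rw [← sum_prodDist_marginal D i (fun v => if θ ≤ f (update x i v) then
      G (min (m.nat 6) v) (m.nat 7) else G (m.nat 6) (max (m.nat 7) v))]
  simp only [sampleProg, seqOps, progExp, opExp]
  refine Finset.sum_le_sum fun y _ => mul_le_mul_of_nonneg_left ?_ ENNReal.toReal_nonneg
  simp only [Memory.setNat, Memory.setReal, Memory.setPt, Test.Holds, update_self, ne_eq,
    Nat.reduceEqDiff, not_false_eq_true, update_of_ne, hm.nat_eight,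
    hm.nat_twelve, hm.nat_four, hm.real_six, coord_val, replaceCoord_val, add_zero, hm.pt_zero,
    zero_ne_one]
  have hI : ∀ m' : Memory n d, m'.nat 0 = m.nat 0 → m'.nat 1 = m.nat 1 → m'.nat 2 = m.nat 2 →
      m'.nat 3 = m.nat 3 → m'.nat 4 = m.nat 4 → m'.nat 8 = m.nat 8 → m'.nat 10 = m.nat 10 →
      m'.nat 12 = 0 → m'.real = update m.real 7 (f (update x i (y i))) →
      m'.pt 0 = update x i (y i) → m'.nat 5 = m.nat 5 + j → G (m'.nat 6) (m'.nat 7) ≤ Φ m' := by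
    intro m' h0 h1 h2 h3 h4 h8 h10 h12 hr hp h5
    refine hΦ m' ⟨h0.trans hm.1, h1.trans hm.2, h2.trans hm.3, h3.trans hm.4, h4.trans hm.5,
      h8.trans hm.6, h10.trans hm.7, h12, ?_, ?_, ?_, ?_⟩ h5
    · rw [hr, update_of_ne (by decide), hm.real_one]
    · rw [hr, update_of_ne (by decide), hm.real_six]
    · rw [hr, update_of_ne (by decide), hm.real_eight]
    · intro v
      rw [hp, update_idem]
  by_cases h1 : θ ≤ f (update x i (y i))
  · rw [if_pos h1, if_neg (not_lt.mpr h1)]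
    split_ifs with h2
    · rw [min_eq_right h2.le]
      refine le_trans (le_of_eq ?_) (hI _ ?_ ?_ ?_ ?_ ?_ ?_ ?_ ?_ rfl ?_ ?_) <;>
        simp [hm.nat_twelve]
    · rw [min_eq_left (not_lt.mp h2)]
      refine le_trans (le_of_eq ?_) (hI _ ?_ ?_ ?_ ?_ ?_ ?_ ?_ ?_ rfl ?_ ?_) <;> simp
  · rw [if_neg h1, if_pos (not_le.mp h1)]
    split_ifs with h2
    · rw [max_eq_right h2.le]
      refine le_trans (le_of_eq ?_) (hI _ ?_ ?_ ?_ ?_ ?_ ?_ ?_ ?_ rfl ?_ ?_) <;>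
        simp [hm.nat_twelve]
    · rw [max_eq_left (not_lt.mp h2)]
      refine le_trans (le_of_eq ?_) (hI _ ?_ ?_ ?_ ?_ ?_ ?_ ?_ ?_ rfl ?_ ?_) <;> simp

/-- `β` and `α` bound the continuation after a violation and without one. The hypotheses on `k` say
that the counter reaches `N` after exactly `k` passes. -/
theorem le_value_sampleLoop {N j flag : ℕ} {a r θ : ℝ} {i : Fin d} {x : Fin d → Fin n}
    {α β : ℝ} {T : ℕ} {cont : List Prog}
    (hend : ∀ m, LineState N j flag a r θ i x m →
      (if m.nat 6 < m.nat 7 then β else α) ≤ value (prodDist D) f A T (cont, m))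
    (k : ℕ) (m : Memory n d) (hm : LineState N j flag a r θ i x m)
    (hk : N ≤ m.nat 5 + k * j) (hk' : ∀ k' < k, m.nat 5 + k' * j < N) :
    lineDetectProb D f k θ i x (m.nat 6) (m.nat 7) * β +
      (1 - lineDetectProb D f k θ i x (m.nat 6) (m.nat 7)) * α ≤
        value (prodDist D) f A (T + (k * 14 + 1))
          (.loop (.natLt 5 3) sampleProg :: cont, m) := by
  induction k generalizing m with
  | zero =>
    rw [Nat.zero_mul, zero_add, value_loop_of_not_holds]
    · refine le_trans (le_of_eq ?_) (hend m hm)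
      simp only [lineDetectProb, detectProb]
      split_ifs <;> ring
    · simp only [Test.Holds, hm.nat_three]
      omega
  | succ k ih =>
    have e : T + ((k + 1) * 14 + 1) = T + (k * 14 + 1) + loopFreeTime sampleProg + 1 := by
      have : loopFreeTime sampleProg = 13 := by decide
      rw [this]; ring
    rw [e, value_loop_of_holds]
    swap
    · simp only [Test.Holds, hm.nat_three]
      simpa using hk' 0 (Nat.succ_pos k)
    refine le_trans ?_ (progExp_le_value (prodDist D) f A (c := sampleProg)
      (by simp [sampleProg, seqOps, LoopFree]) (fun _ => le_rfl) m)
    set G : ℕ → ℕ → ℝ := fun lo hi => lineDetectProb D f k θ i x lo hi * β +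
      (1 - lineDetectProb D f k θ i x lo hi) * α with hG
    have hstep : ∑ v, (D i v).toReal * (if θ ≤ f (update x i v) then
        G (min (m.nat 6) v) (m.nat 7) else G (m.nat 6) (max (m.nat 7) v)) =
        lineDetectProb D f (k + 1) θ i x (m.nat 6) (m.nat 7) * β +
          (1 - lineDetectProb D f (k + 1) θ i x (m.nat 6) (m.nat 7)) * α := by
      have : ∀ v, (D i v).toReal * (if θ ≤ f (update x i v) then
          G (min (m.nat 6) v) (m.nat 7) else G (m.nat 6) (max (m.nat 7) v)) =
          (D i v).toReal * α + ((D i v).toReal * (if θ ≤ f (update x i v) then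
            lineDetectProb D f k θ i x (min (m.nat 6) v) (m.nat 7)
            else lineDetectProb D f k θ i x (m.nat 6) (max (m.nat 7) v))) * (β - α) := by
        intro v
        simp only [hG]
        split_ifs <;> ring
      simp only [this]
      rw [Finset.sum_add_distrib, ← Finset.sum_mul, ← Finset.sum_mul, sum_toReal_eq_one]
      simp only [lineDetectProb, detectProb]
      ring
    rw [← hstep]
    refine le_progExp_sampleProg D f hm fun m' hm' h5 => ih m' hm' ?_ fun k' hk'' => ?_
    · rw [h5]; linarith
    · rw [h5]
      have := hk' (k' + 1) (by omega)
      linarith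

/-- The average over a random direction `i`, a random number `s < N` and a random point `x`. -/
def lineAvg (N : ℕ) (F : Fin d → ℕ → (Fin d → Fin n) → ℝ) : ℝ :=
  (∑ i : Fin d, (∑ s ∈ Finset.range N, ∑ x, (prodDist D x).toReal * F i s x) / N) / d

theorem lineAvg_mono {N : ℕ} {F G : Fin d → ℕ → (Fin d → Fin n) → ℝ}
    (h : ∀ i s x, F i s x ≤ G i s x) : lineAvg D N F ≤ lineAvg D N G := by
  unfold lineAvg
  gcongr with i _ s _ x _
  exact h i s x

theorem lineAvg_affine (hd : 0 < d) {N : ℕ} (hN : 0 < N)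
    (F : Fin d → ℕ → (Fin d → Fin n) → ℝ) (c e : ℝ) :
    lineAvg D N (fun i s x => F i s x * c + e) = lineAvg D N F * c + e := by
  have hd' : (d : ℝ) ≠ 0 := by exact_mod_cast hd.ne'
  have hN' : (N : ℝ) ≠ 0 := by exact_mod_cast hN.ne'
  have : ∀ (i : Fin d) (s : ℕ) (x : Fin d → Fin n), (prodDist D x).toReal *
      (F i s x * c + e) = ((prodDist D x).toReal * F i s x) * c + (prodDist D x).toReal * e :=
    fun i s x => by ring
  simp only [lineAvg, this, Finset.sum_add_distrib, ← Finset.sum_mul, sum_prodDist_toReal,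
    Finset.sum_const, Finset.card_range, one_mul, nsmul_eq_mul, add_div,
    mul_div_cancel_left₀ _ hN', Finset.card_univ, Fintype.card_fin, mul_div_cancel_left₀ _ hd',
    mul_div_right_comm]

theorem lineAvg_sum {κ : Type*} (t : Finset κ) (N : ℕ)
    (F : κ → Fin d → ℕ → (Fin d → Fin n) → ℝ) :
    lineAvg D N (fun i s x => ∑ j ∈ t, F j i s x) = ∑ j ∈ t, lineAvg D N (F j) := by
  unfold lineAvg
  simp only [Finset.mul_sum, Finset.sum_div]
  symm
  rw [Finset.sum_comm]
  refine Finset.sum_congr rfl fun i _ => ?_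
  rw [Finset.sum_comm]
  refine Finset.sum_congr rfl fun s _ => ?_
  rw [Finset.sum_comm]

/-- The probability that one of `k` samples on a random line reveals a violation of monotonicity. -/
def roundDetectProb (a r : ℝ) (N k : ℕ) : ℝ :=
  lineAvg D N fun i s x => lineDetectProb D f k (a + ((s : ℝ) + 1) * r) i x n 0

theorem le_progExp_lineProg {N j flag : ℕ} (hd : 0 < d) (hN : 0 < N) {a r : ℝ} {m : Memory n d}
    (hm : RoundState N j flag a r m)
    {Φ : Memory n d → ℝ} {G : Fin d → ℕ → (Fin d → Fin n) → ℝ}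
    (hΦ : ∀ (i : Fin d) (s : ℕ) (x : Fin d → Fin n) (m' : Memory n d), LineState N (j + 1) flag a r (a + ((s : ℝ) + 1) * r) i x m' →
      m'.nat 5 = 0 → m'.nat 6 = n → m'.nat 7 = 0 → G i s x ≤ Φ m') :
    lineAvg D N G ≤ progExp (prodDist D) f lineProg Φ m := by
  simp only [lineAvg, lineProg, seqOps, progExp, opExp]
  simp only [Memory.setNat, Memory.setReal, Memory.setPt, update_self, ne_eq,
    Nat.reduceEqDiff, not_false_eq_true, update_of_ne, hm.nat_one, hm.nat_two, hm.nat_three,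
    hm.nat_four, hm.nat_ten,
    hm.nat_twelve, hm.real_one, hm.real_eight, add_zero, hd.ne', hN.ne', if_false]
  rw [← Fin.sum_univ_eq_sum_range (n := d)]
  gcongr with i _ s hs x _
  refine hΦ i s x _ ⟨?_, ?_, ?_, ?_, ?_, ?_, ?_, ?_, ?_, ?_, ?_, ?_⟩ ?_ ?_ ?_ <;>
    simp [hm.nat_zero, hm.nat_one, hm.nat_two, hm.nat_three, hm.nat_ten,
      hm.nat_twelve, hm.real_one, hm.real_eight]

theorem le_value_roundProg {N j flag : ℕ} (hd : 0 < d) (hN : 0 < N) {a r : ℝ} {m : Memory n d}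
    (hm : RoundState N j flag a r m) {α β : ℝ} {T : ℕ} {cont : List Prog}
    (hβ : ∀ m, RoundState N (j + 1) 0 a r m → β ≤ value (prodDist D) f A T (cont, m))
    (hα : ∀ m, RoundState N (j + 1) flag a r m → α ≤ value (prodDist D) f A T (cont, m))
    {k : ℕ} (hk : N ≤ k * (j + 1)) (hk' : ∀ k' < k, k' * (j + 1) < N) :
    roundDetectProb D f a r N k * β + (1 - roundDetectProb D f a r N k) * α ≤
      value (prodDist D) f A (T + (k * 14 + 26)) (roundProg :: cont, m) := by
  have e : T + (k * 14 + 26) =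
      T + loopFreeTime verdictProg + (k * 14 + 1) + 1 + loopFreeTime lineProg + 1 := by
    have h1 : loopFreeTime verdictProg = 2 := by decide
    have h2 : loopFreeTime lineProg = 21 := by decide
    rw [h1, h2]; ring
  rw [e, roundProg, value_seq]
  refine le_trans ?_ (progExp_le_value (prodDist D) f A (c := lineProg)
    (by simp [lineProg, seqOps, LoopFree]) (fun _ => le_rfl) m)
  have hlin : roundDetectProb D f a r N k * β + (1 - roundDetectProb D f a r N k) * α =
      lineAvg D N fun i s x => lineDetectProb D f k (a + ((s : ℝ) + 1) * r) i x n 0 * (β - α) + α := by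
    rw [lineAvg_affine D hd hN fun i s x =>
      lineDetectProb D f k (a + ((s : ℝ) + 1) * r) i x n 0, roundDetectProb]
    ring
  rw [hlin]
  refine le_progExp_lineProg D f hd hN hm fun i s x m' hm' h5 h6 h7 => ?_
  rw [value_seq]
  have h := le_value_sampleLoop D f A (T := T + loopFreeTime verdictProg)
    (cont := verdictProg :: cont) (α := α) (β := β) (fun m'' hm'' => ?_) k m' hm' ?_ ?_
  · rw [h6, h7] at h
    refine le_trans (le_of_eq (by ring)) h
  · refine le_trans ?_ (progExp_le_value (prodDist D) f A (c := verdictProg)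
      (by simp [verdictProg, LoopFree]) (fun _ => le_rfl) m'')
    simp only [verdictProg, progExp, opExp, Test.Holds]
    have h := hm''.roundState
    by_cases hlt : m''.nat 6 < m''.nat 7
    · simp only [hlt, if_true]
      refine hβ _ ⟨?_, ?_, ?_, ?_, ?_, ?_, ?_, ?_, ?_⟩ <;>
        simp [Memory.setNat, h.nat_one, h.nat_two, h.nat_three, h.nat_four, h.nat_ten,
          h.nat_twelve, h.real_one, h.real_eight]
    · simp only [hlt, if_false]
      refine hα _ ⟨?_, ?_, ?_, ?_, ?_, ?_, ?_, ?_, ?_⟩ <;>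
        simp [Memory.setNat, h.nat_zero, h.nat_one, h.nat_two, h.nat_three, h.nat_four, h.nat_ten,
          h.real_one, h.real_eight]
  · rw [h5, zero_add]; exact hk
  · rw [h5]
    simpa using hk'

/-- The number of samples in round `j + 1` of `N`. -/
def sampleCount (N j : ℕ) : ℕ := ⌈(N : ℝ) / ((j : ℝ) + 1)⌉₊

theorem le_sampleCount_mul (N j : ℕ) : N ≤ sampleCount N j * (j + 1) := by
  have h := Nat.le_ceil ((N : ℝ) / ((j : ℝ) + 1))
  rw [div_le_iff₀ (by positivity)] at h
  unfold sampleCount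
  exact_mod_cast h

theorem mul_lt_of_lt_sampleCount {N j k : ℕ} (h : k < sampleCount N j) : k * (j + 1) < N := by
  have h := Nat.lt_ceil.mp h
  rw [lt_div_iff₀ (by positivity)] at h
  exact_mod_cast h

/-- The verdict 0 is permanent, so from verdict 0 both outcomes of a round are worth `β`. From
verdict 1, independence of the rounds produces the product of the failure probabilities. -/
theorem le_value_roundLoop {N : ℕ} (hd : 0 < d) {a r : ℝ} {α β : ℝ} {T : ℕ} {cont : List Prog}
    (hβ : ∀ m, RoundState N N 0 a r m → β ≤ value (prodDist D) f A T (cont, m))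
    (hα : ∀ m, RoundState N N 1 a r m → α ≤ value (prodDist D) f A T (cont, m))
    (e j : ℕ) (hj : j + e = N) :
    (∀ m, RoundState N j 0 a r m → β ≤ value (prodDist D) f A
      (T + (∑ s ∈ Finset.Ico j N, (sampleCount N s * 14 + 27) + 1))
        (.loop (.natLt 4 3) roundProg :: cont, m)) ∧
    ∀ m, RoundState N j 1 a r m →
      (1 - ∏ s ∈ Finset.Ico j N, (1 - roundDetectProb D f a r N (sampleCount N s))) * β +
        (∏ s ∈ Finset.Ico j N, (1 - roundDetectProb D f a r N (sampleCount N s))) * α ≤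
        value (prodDist D) f A (T + (∑ s ∈ Finset.Ico j N, (sampleCount N s * 14 + 27) + 1))
          (.loop (.natLt 4 3) roundProg :: cont, m) := by
  induction e generalizing j with
  | zero =>
    obtain rfl : j = N := by simpa using hj
    simp only [Finset.Ico_self, Finset.sum_empty, Finset.prod_empty, zero_add, sub_self, zero_mul,
      one_mul]
    refine ⟨fun m hm => ?_, fun m hm => ?_⟩
    · rw [value_loop_of_not_holds _ _ _ _ _ _ (by simp [Test.Holds, hm.nat_three, hm.nat_four])]
      exact hβ m hm
    · rw [value_loop_of_not_holds _ _ _ _ _ _ (by simp [Test.Holds, hm.nat_three, hm.nat_four])]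
      exact hα m hm
  | succ e ih =>
    obtain ⟨ih0, ih1⟩ := ih (j + 1) (by omega)
    have hjN : j < N := by omega
    rw [Finset.sum_eq_sum_Ico_succ_bot hjN, Finset.prod_eq_prod_Ico_succ_bot hjN]
    have et : T + (sampleCount N j * 14 + 27 +
        ∑ s ∈ Finset.Ico (j + 1) N, (sampleCount N s * 14 + 27) + 1) =
        T + (∑ s ∈ Finset.Ico (j + 1) N, (sampleCount N s * 14 + 27) + 1) +
          (sampleCount N j * 14 + 26) + 1 := by ring
    rw [et]
    refine ⟨fun m hm => ?_, fun m hm => ?_⟩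
    · rw [value_loop_of_holds _ _ _ _ _ _ (by simp [Test.Holds, hm.nat_three, hm.nat_four, hjN])]
      refine le_trans (le_of_eq (by ring)) (le_value_roundProg D f A hd (by omega) hm ih0 ih0
        (le_sampleCount_mul N j) fun k' => mul_lt_of_lt_sampleCount)
    · rw [value_loop_of_holds _ _ _ _ _ _ (by simp [Test.Holds, hm.nat_three, hm.nat_four, hjN])]
      refine le_trans (le_of_eq (by ring)) (le_value_roundProg D f A hd (by omega) hm ih0 ih1
        (le_sampleCount_mul N j) fun k' => mul_lt_of_lt_sampleCount)

/-- The memory while the number of rounds is computed. -/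
structure CountState (c : ℕ) (a b y : ℝ) (m : Memory n d) : Prop where
  nat_one : m.nat 1 = n
  nat_two : m.nat 2 = d
  nat_three : m.nat 3 = c
  nat_four : m.nat 4 = 0
  nat_ten : m.nat 10 = 1
  nat_twelve : m.nat 12 = 0
  real_one : m.real 1 = a
  real_two : m.real 2 = b
  real_three : m.real 3 = y
  real_four : m.real 4 = c

/-- The machine cannot round reals, so `⌈y⌉₊` is found by counting up; this costs time linear in the
number of rounds. -/
theorem le_value_countLoop {a b y : ℝ} {α : ℝ} {T : ℕ} {cont : List Prog}
    (hα : ∀ m, CountState ⌈y⌉₊ a b y m → α ≤ value (prodDist D) f A T (cont, m))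
    (e c : ℕ) (hc : c + e = ⌈y⌉₊) (m : Memory n d) (hm : CountState c a b y m) :
    α ≤ value (prodDist D) f A (T + (e * 4 + 1)) (.loop (.realLt 4 3) countProg :: cont, m) := by
  induction e generalizing c m with
  | zero =>
    obtain rfl : c = ⌈y⌉₊ := by simpa using hc
    rw [zero_mul, zero_add, value_loop_of_not_holds _ _ _ _ _ _
      (by simp only [Test.Holds, hm.real_three, hm.real_four, not_lt]; exact Nat.le_ceil y)]
    exact hα m hm
  | succ e ih =>
    have et : T + ((e + 1) * 4 + 1) = T + (e * 4 + 1) + loopFreeTime countProg + 1 := by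
      have : loopFreeTime countProg = 3 := by decide
      rw [this]; ring
    have hlt : (c : ℝ) < y := Nat.lt_ceil.mp (by omega)
    rw [et, value_loop_of_holds _ _ _ _ _ _
      (by simp only [Test.Holds, hm.real_three, hm.real_four]; exact hlt)]
    refine le_trans ?_ (progExp_le_value (prodDist D) f A (c := countProg)
      (by simp [countProg, seqOps, LoopFree]) (fun _ => le_rfl) m)
    simp only [countProg, seqOps, progExp, opExp]
    refine ih (c + 1) (by omega) _ ⟨?_, ?_, ?_, ?_, ?_, ?_, ?_, ?_, ?_, ?_⟩ <;>
      simp [Memory.setNat, Memory.setReal, hm.nat_one, hm.nat_two, hm.nat_three, hm.nat_four,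
        hm.nat_ten, hm.nat_twelve, hm.real_one, hm.real_two, hm.real_three]

/-- A bound for the running time of the tester with `N` rounds. -/
def testerTime (N : ℕ) : ℕ :=
  ∑ s ∈ Finset.range N, (sampleCount N s * 14 + 27) + N * 4 + 25

/-- The probability that no round out of `N` reveals a violation of monotonicity. -/
def surviveProb (a b : ℝ) (N : ℕ) : ℝ :=
  ∏ s ∈ Finset.range N, (1 - roundDetectProb D f a ((b - a) / N) N (sampleCount N s))

/-- The arbitrary predicate `P` on the verdict lets one lower bound serve for halting, acceptance
and rejection. -/
theorem le_value_tester [NeZero n] {p : ℕ} (hp : p = 1 ∨ p = 2) (hd : 0 < d) (a b ε : ℝ)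
    {N : ℕ} (hN : N = ⌈(64 * d : ℝ) / ε ^ p⌉₊) (P : ℕ → Prop) :
    (1 - surviveProb D f a b N) * (if P 0 then 1 else 0) +
      surviveProb D f a b N * (if P 1 then 1 else 0) ≤
      value (prodDist D) f {m | P (m.nat 0)} (testerTime N)
        ([tester p], initMemory n d ε a b) := by
  set A : Set (Memory n d) := {m | P (m.nat 0)}
  set S := ∑ s ∈ Finset.Ico 0 N, (sampleCount N s * 14 + 27) with hS
  have et : testerTime N = 0 + (S + 1) + loopFreeTime setupProg + 1 + (N * 4 + 1) + 1 +
      loopFreeTime (targetProg p) + 1 := by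
    have h1 : loopFreeTime setupProg = 5 := by decide
    have h2 : loopFreeTime (targetProg p) = 15 := by
      simp [targetProg, seqOps, loopFreeTime]
    rw [h1, h2, hS, ← Finset.range_eq_Ico, testerTime]; ring
  rw [et, tester, value_seq]
  refine le_trans ?_ (progExp_le_value (prodDist D) f A (c := targetProg p)
    (by simp [targetProg, seqOps, LoopFree]) (fun _ => le_rfl) _)
  simp only [targetProg, seqOps, progExp, opExp]
  rw [value_seq]
  refine le_value_countLoop D f A (a := a) (b := b) (y := (64 * d : ℝ) / ε ^ p) (fun m hm => ?_)
    N 0 (by rw [hN, zero_add]) _ ⟨?_, ?_, ?_, ?_, ?_, ?_, ?_, ?_, ?_, ?_⟩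
  · rw [value_seq]
    refine le_trans ?_ (progExp_le_value (prodDist D) f A (c := setupProg)
      (by simp [setupProg, seqOps, LoopFree]) (fun _ => le_rfl) m)
    simp only [setupProg, seqOps, progExp, opExp]
    rw [← hN] at hm
    have h := (le_value_roundLoop D f A (N := N) (T := 0) (cont := []) hd (a := a)
      (r := (b - a) / N) (α := if P 1 then 1 else 0) (β := if P 0 then 1 else 0)
      (fun m hm => by rw [value_nil]; simp [A, hm.nat_zero])
      (fun m hm => by rw [value_nil]; simp [A, hm.nat_zero]) N 0 (zero_add N)).2
    rw [surviveProb, Finset.range_eq_Ico]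
    refine h _ ⟨?_, ?_, ?_, ?_, ?_, ?_, ?_, ?_, ?_⟩ <;>
      simp [Memory.setNat, Memory.setReal, hm.nat_one, hm.nat_two, hm.nat_three, hm.nat_four,
        hm.nat_ten, hm.nat_twelve, hm.real_one, hm.real_two, hm.real_four]
  all_goals
    rcases hp with rfl | rfl <;>
      simp [Memory.setNat, Memory.setReal, initMemory, pow_two]

end Tester

/-! ### Correctness and running time. -/

noncomputable section Analysis

variable {n d : ℕ} (D : Fin d → PMF (Fin n)) (f : (Fin d → Fin n) → ℝ)

theorem roundDetectProb_mem_Icc (hd : 0 < d) {N : ℕ} (hN : 0 < N) (a r : ℝ) (k : ℕ) :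
    roundDetectProb D f a r N k ∈ Set.Icc (0 : ℝ) 1 := by
  have h : ∀ (i : Fin d) (s : ℕ) (x : Fin d → Fin n),
      lineDetectProb D f k (a + ((s : ℝ) + 1) * r) i x n 0 ∈ Set.Icc (0 : ℝ) 1 := fun i s x =>
    detectProb_mem_Icc (fun v => ENNReal.toReal_nonneg) (sum_toReal_eq_one _) _ _ _ _
  have hc : ∀ c : ℝ, lineAvg D N (fun _ _ _ => c) = c := fun c => by
    have := lineAvg_affine D hd hN (fun _ _ _ => 0) 0 c
    simpa using this
  constructor
  · rw [← hc 0]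
    exact lineAvg_mono D fun i s x => (h i s x).1
  · rw [← hc 1]
    exact lineAvg_mono D fun i s x => (h i s x).2

variable {f}

theorem surviveProb_eq_one_of_monotone (hf : Monotone f) (a b : ℝ) (N : ℕ) :
    surviveProb D f a b N = 1 := by
  refine Finset.prod_eq_one fun j _ => ?_
  have h : ∀ (θ : ℝ) (i : Fin d) (x : Fin d → Fin n),
      lineDetectProb D f (sampleCount N j) θ i x n 0 = 0 := by
    intro θ i x
    refine detectProb_eq_zero _ (fun u v hu hv => ?_) _ (Nat.zero_le _) (fun _ _ => Nat.zero_le _)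
      fun v _ => v.2.le
    by_contra hcon
    exact hv (hu.trans (hf (update_le_update_iff.mpr ⟨(not_le.mp hcon).le, fun _ _ => le_rfl⟩)))
  simp [roundDetectProb, h, lineAvg]

variable (f)

/-- The distance to monotonicity of the level sets, averaged over lines and thresholds. -/
def avgLineError (a b : ℝ) (N : ℕ) : ℝ :=
  lineAvg D N fun i s x => lineError (fun v => (D i v).toReal)
    fun v => a + ((s : ℝ) + 1) * ((b - a) / N) ≤ f (update x i v)

/-- For a line of error `X`, the rounds with `j + 1 ≤ N * X / 4` each detect with probability at
least `1 / 2`. There are `⌊N * X / 4⌋` of them, and the floor costs the final `1 / 2`. -/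
theorem le_sum_roundDetectProb (hd : 0 < d) {N : ℕ} (hN : 0 < N) (a b : ℝ) :
    N * avgLineError D f a b N / 8 - 1 / 2 ≤
      ∑ j ∈ Finset.range N, roundDetectProb D f a ((b - a) / N) N (sampleCount N j) := by
  have hN' : (0 : ℝ) < N := by exact_mod_cast hN
  unfold roundDetectProb
  rw [← lineAvg_sum]
  have e : N * avgLineError D f a b N / 8 - 1 / 2 =
      avgLineError D f a b N * (N / 8) + (-(1 / 2)) := by ring
  rw [e, avgLineError, ← lineAvg_affine D hd hN]
  refine lineAvg_mono D fun i s x => ?_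
  set one : Fin n → Prop := fun v => a + ((s : ℝ) + 1) * ((b - a) / N) ≤ f (update x i v)
  set w : Fin n → ℝ := fun v => (D i v).toReal
  have hw : ∀ v, 0 ≤ w v := fun v => ENNReal.toReal_nonneg
  have hsum : ∑ v, w v = 1 := sum_toReal_eq_one _
  set X := lineError w one
  have hX : X ≤ 1 := lineError_le_one hw hsum one
  have hy : N * X / 4 ≤ (N : ℝ) := by nlinarith
  have h1 := sum_range_ite_le_eq_floor hy
  have h2 := Nat.lt_floor_add_one (N * X / 4)
  have h3 : ∑ j ∈ Finset.range N, (if (j : ℝ) + 1 ≤ N * X / 4 then (1 : ℝ) else 0) / 2 ≤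
      ∑ j ∈ Finset.range N, lineDetectProb D f (sampleCount N j)
        (a + ((s : ℝ) + 1) * ((b - a) / N)) i x n 0 := by
    refine Finset.sum_le_sum fun j _ => ?_
    split_ifs with hj
    -- The error level `4 * (j + 1) / N` is the one for which `⌈N / (j + 1)⌉` samples suffice.
    · refine half_le_detectProb hw hsum (x := 4 * ((j : ℝ) + 1) / N) (by positivity) ?_ ?_ _ _
      · rw [div_le_iff₀ hN']
        show _ ≤ X * N
        linarith
      · have h4 : (N : ℝ) ≤ sampleCount N j * ((j : ℝ) + 1) := by
          exact_mod_cast le_sampleCount_mul N j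
        rw [div_mul_eq_mul_div, le_div_iff₀ hN']
        linarith
    · rw [zero_div]
      exact (detectProb_mem_Icc hw hsum _ _ _ _).1
  rw [← Finset.sum_div, h1] at h3
  linarith

/-- Since `1 - q ≤ exp (-q)`, it suffices that the detection probabilities sum to `20 / 8 - 1 / 2 =
2`. -/
theorem surviveProb_le (hd : 0 < d) {N : ℕ} (hN : 0 < N) {a b : ℝ}
    (h : 20 ≤ N * avgLineError D f a b N) : surviveProb D f a b N ≤ 1 / 3 := by
  have h1 := le_sum_roundDetectProb D f hd hN a b
  have hQ := fun k => roundDetectProb_mem_Icc D f hd hN a ((b - a) / N) k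
  calc surviveProb D f a b N ≤ ∏ j ∈ Finset.range N,
        Real.exp (-roundDetectProb D f a ((b - a) / N) N (sampleCount N j)) :=
        Finset.prod_le_prod (fun j _ => by linarith [(hQ (sampleCount N j)).2]) fun j _ => by
          linarith [Real.add_one_le_exp (-roundDetectProb D f a ((b - a) / N) N (sampleCount N j))]
    _ = Real.exp (-∑ j ∈ Finset.range N,
        roundDetectProb D f a ((b - a) / N) N (sampleCount N j)) := by
        rw [← Finset.sum_neg_distrib, Real.exp_sum]
    _ ≤ Real.exp (-2) := Real.exp_le_exp.mpr (by linarith)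
    _ ≤ 1 / 3 := by
        rw [Real.exp_neg, inv_eq_one_div]
        exact one_div_le_one_div_of_le (by norm_num) (by linarith [Real.add_one_le_exp (2 : ℝ)])

variable {f}

/-- A function is at most twice as far from monotone as its restrictions to lines. -/
theorem le_avgLineError [NeZero n] (hd : 0 < d) {a b : ℝ} (hab : a < b)
    (hf : ∀ x, f x ∈ Set.Icc a b) {τ : ℝ}
    (hfar : ∀ g : (Fin d → Fin n) → ℝ, Monotone g →
      τ * (b - a) ≤ ∑ x, (prodDist D x).toReal * |f x - g x|)
    {N : ℕ} (hN : 0 < N) : τ / (2 * d) ≤ 1 / N + avgLineError D f a b N := by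
  set w : Fin d → Fin n → ℝ := fun i v => (D i v).toReal with hwdef
  have hw : ∀ i v, 0 ≤ w i v := fun i v => ENNReal.toReal_nonneg
  have hsum : ∀ i, ∑ v, w i v = 1 := fun i => sum_toReal_eq_one _
  have hN' : (0 : ℝ) < N := by exact_mod_cast hN
  have hd' : (0 : ℝ) < d := by exact_mod_cast hd
  have hba : 0 < b - a := sub_pos.mpr hab
  choose G hG hGle using fun (i : Fin d) (x : Fin d → Fin n) =>
    exists_monotone_line_approx (hw i) (hsum i) hab (h := fun v => f (update x i v))
      (fun v => hf _) hN
  -- choose the approximation as a function of the line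
  let L : Fin d → (Fin d → Fin n) → Fin n → ℝ := fun i x => G i (update x i 0)
  have hL : ∀ i x v, L i (update x i v) = L i x := fun i x v => by simp [L]
  have hLle : ∀ i x, ∑ v, w i v * |f (update x i v) - L i x v| ≤ (b - a) / N *
      (1 + ∑ s ∈ Finset.range N, lineError (w i)
        fun v => a + ((s : ℝ) + 1) * ((b - a) / N) ≤ f (update x i v)) := by
    intro i x
    have := hGle i (update x i 0)
    simpa only [update_idem] using this
  let g : Fin d → (Fin d → Fin n) → ℝ := fun i x => L i x (x i)
  have hg : ∀ i, DirMono i (g i) := by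
    intro i x u v huv
    simp only [g, hL, update_self]
    exact hG _ _ huv
  have hdist : ∀ i, prodDistL1 w f (g i) ≤ (b - a) / N *
      (1 + ∑ s ∈ Finset.range N, ∑ x, (prodDist D x).toReal * lineError (w i)
        fun v => a + ((s : ℝ) + 1) * ((b - a) / N) ≤ f (update x i v)) := by
    intro i
    have h1 := sum_prod_mul_sum_update w i (fun x => |f x - g i x|)
    rw [hsum, one_mul] at h1
    unfold prodDistL1
    rw [← h1]
    simp only [g, hL, update_self, hwdef, ← prodDist_toReal]
    calc _ ≤ ∑ x, (prodDist D x).toReal * ((b - a) / N *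
        (1 + ∑ s ∈ Finset.range N, lineError (w i)
          fun v => a + ((s : ℝ) + 1) * ((b - a) / N) ≤ f (update x i v))) :=
          Finset.sum_le_sum fun x _ => mul_le_mul_of_nonneg_left (hLle i x) ENNReal.toReal_nonneg
      _ = _ := by
          rw [Finset.sum_comm]
          have : ∀ x, (prodDist D x).toReal * ((b - a) / N *
              (1 + ∑ s ∈ Finset.range N, lineError (w i)
                fun v => a + ((s : ℝ) + 1) * ((b - a) / N) ≤ f (update x i v))) =
              (b - a) / N * ((prodDist D x).toReal + ∑ s ∈ Finset.range N,
                (prodDist D x).toReal * lineError (w i)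
                  fun v => a + ((s : ℝ) + 1) * ((b - a) / N) ≤ f (update x i v)) := fun x => by
            rw [← Finset.mul_sum]; ring
          simp only [this]
          rw [← Finset.mul_sum, Finset.sum_add_distrib, sum_prodDist_toReal]
  have hsumdist : ∑ i, prodDistL1 w f (g i) ≤ (b - a) * (d * (1 / N + avgLineError D f a b N)) := by
    refine (Finset.sum_le_sum fun i _ => hdist i).trans_eq ?_
    rw [← Finset.mul_sum, Finset.sum_add_distrib, avgLineError, lineAvg, ← Finset.sum_div]
    simp only [Finset.sum_const, Finset.card_univ, Fintype.card_fin, nsmul_eq_mul, mul_one]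
    field_simp
    rfl
  have hδ : ∀ δ : ℝ, 0 < δ →
      τ * (b - a) ≤ 2 * ((b - a) * (d * (1 / N + avgLineError D f a b N))) + δ := by
    intro δ hδ
    obtain ⟨h, hh, hle⟩ := exists_monotone_prodDistL1_le hw f g hg hδ
    have h1 := hfar h hh
    simp only [prodDist_toReal] at h1
    unfold prodDistL1 at hle hsumdist
    linarith
  have h1 := le_of_forall_pos_le_add hδ
  have h2 : τ ≤ 2 * (d * (1 / N + avgLineError D f a b N)) := by
    refine le_of_mul_le_mul_right ?_ hba
    linarith
  rw [div_le_iff₀ (by positivity)]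
  linarith

/-- A function that is far from monotone in `L_p` is far from monotone in `L_1`. -/
theorem le_sum_abs_of_lt_lpDistTo {α : Type*} [Fintype α] [Preorder α] (μ : PMF α) {p : ℕ}
    (hp : 0 < p) {f : α → ℝ} {a b ε : ℝ} (hab : a < b) (hε : 0 < ε)
    (hf : ∀ x, f x ∈ Set.Icc a b)
    (hfar : ε < lpDistTo μ p (b - a) f {g | Monotone g}) {g : α → ℝ} (hg : Monotone g) :
    ε ^ p * (b - a) ≤ ∑ x, (μ x).toReal * |f x - g x| := by
  have hba : 0 < b - a := sub_pos.mpr hab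
  have hp' : (p : ℝ) ≠ 0 := by exact_mod_cast hp.ne'
  set g' : α → ℝ := fun x => max a (min b (g x)) with hg'
  have hmono : Monotone g' := fun x y hxy => max_le_max le_rfl (min_le_min le_rfl (hg hxy))
  have hclose : ∀ x, |f x - g' x| ≤ |f x - g x| := by
    intro x
    obtain ⟨h1, h2⟩ := hf x
    simp only [hg']
    rcases le_total b (g x) with h | h
    · rw [min_eq_left h, max_eq_right hab.le, abs_le]
      constructor <;> cases abs_cases (f x - g x) <;> linarith
    · rw [min_eq_right h]
      rcases le_total a (g x) with h3 | h3
      · rw [max_eq_right h3]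
      · rw [max_eq_left h3, abs_le]
        constructor <;> cases abs_cases (f x - g x) <;> linarith
  have hle : ∀ x, |f x - g' x| ≤ b - a := by
    intro x
    obtain ⟨h1, h2⟩ := hf x
    have h3 : a ≤ g' x := le_max_left _ _
    have h4 : g' x ≤ b := max_le hab.le (min_le_left _ _)
    rw [abs_le]
    constructor <;> linarith
  have hS0 : 0 ≤ ∑ x, (μ x).toReal * |f x - g' x| ^ p := Finset.sum_nonneg fun x _ => by positivity
  have hinf : (⨅ g : {g : α → ℝ | Monotone g}, lpDist μ p f g) ≤ lpDist μ p f g' := by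
    refine ciInf_le (f := fun g : {g : α → ℝ | Monotone g} => lpDist μ p f g) ⟨0, ?_⟩ ⟨g', hmono⟩
    rintro _ ⟨k, rfl⟩
    exact Real.rpow_nonneg (Finset.sum_nonneg fun x _ => by positivity) _
  have h1 : ε * (b - a) < lpDist μ p f g' := by
    rw [lpDistTo, one_div, ← div_eq_inv_mul, lt_div_iff₀ hba] at hfar
    exact hfar.trans_le hinf
  have h2 : (ε * (b - a)) ^ p ≤ ∑ x, (μ x).toReal * |f x - g' x| ^ p := by
    refine (pow_le_pow_left₀ (by positivity) h1.le p).trans_eq ?_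
    rw [lpDist, ← Real.rpow_natCast, ← Real.rpow_mul hS0, one_div, inv_mul_cancel₀ hp', Real.rpow_one]
  have h3 : ∑ x, (μ x).toReal * |f x - g' x| ^ p ≤
      (b - a) ^ (p - 1) * ∑ x, (μ x).toReal * |f x - g x| := by
    rw [Finset.mul_sum]
    refine Finset.sum_le_sum fun x _ => ?_
    have e : |f x - g' x| ^ p = |f x - g' x| ^ (p - 1) * |f x - g' x| := by
      rw [← pow_succ, Nat.sub_add_cancel hp]
    rw [e, mul_left_comm]
    refine mul_le_mul (pow_le_pow_left₀ (abs_nonneg _) (hle x) _) ?_ (by positivity) (by positivity)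
    exact mul_le_mul_of_nonneg_left (hclose x) ENNReal.toReal_nonneg
  have h4 : (ε * (b - a)) ^ p = (b - a) ^ (p - 1) * (ε ^ p * (b - a)) := by
    rw [mul_pow]
    conv_lhs => rw [← Nat.sub_add_cancel hp, pow_succ (b - a)]
    rw [Nat.sub_add_cancel hp]
    ring
  rw [h4] at h2
  exact le_of_mul_le_mul_left (h2.trans h3) (by positivity)

theorem testerTime_le {y : ℝ} (hy : 1 ≤ y) :
    (testerTime ⌈64 * y⌉₊ : ℝ) ≤ 300000 * (y * Real.log y + 1) := by
  set N := ⌈64 * y⌉₊ with hNdef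
  have hNpos : 0 < N := Nat.ceil_pos.mpr (by linarith)
  have hN1 : (1 : ℝ) ≤ N := by exact_mod_cast hNpos
  have hN : (N : ℝ) ≤ 65 * y := by
    have := Nat.ceil_lt_add_one (a := 64 * y) (by linarith)
    linarith
  have hcount : ∀ s, (sampleCount N s : ℝ) ≤ N * ((s : ℝ) + 1)⁻¹ + 1 := fun s => by
    rw [← div_eq_mul_inv]
    exact (Nat.ceil_lt_add_one (by positivity)).le
  have hharm : ∑ s ∈ Finset.range N, ((s : ℝ) + 1)⁻¹ ≤ 1 + Real.log N := by
    have := harmonic_le_one_add_log N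
    rw [harmonic] at this
    push_cast at this
    exact this
  have hsum : ∑ s ∈ Finset.range N, (sampleCount N s : ℝ) ≤ N * (1 + Real.log N) + N := by
    calc _ ≤ ∑ s ∈ Finset.range N, (N * ((s : ℝ) + 1)⁻¹ + 1) :=
          Finset.sum_le_sum fun s _ => hcount s
      _ = N * ∑ s ∈ Finset.range N, ((s : ℝ) + 1)⁻¹ + N := by
          rw [Finset.sum_add_distrib, ← Finset.mul_sum]; simp
      _ ≤ _ := by gcongr
  have hlogy : 0 ≤ Real.log y := Real.log_nonneg hy
  have hlogN : Real.log N ≤ 64 + Real.log y := by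
    have h1 := Real.log_le_log (by linarith) hN
    rw [Real.log_mul (by norm_num) (by linarith)] at h1
    have h2 := Real.log_le_sub_one_of_pos (show (0 : ℝ) < 65 by norm_num)
    linarith
  have ht : (testerTime N : ℝ) =
      14 * ∑ s ∈ Finset.range N, (sampleCount N s : ℝ) + 31 * N + 25 := by
    simp only [testerTime]
    push_cast
    rw [Finset.sum_add_distrib, ← Finset.sum_mul]
    simp
    ring
  have hprod : (N : ℝ) * (1 + Real.log N) ≤ 65 * y * (65 + Real.log y) := by
    have := Real.log_nonneg hN1
    exact mul_le_mul hN (by linarith) (by linarith) (by linarith)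
  -- The logarithm vanishes at `y = 1`, so the additive one absorbs the linear term for `y ≤ 3`;
  -- beyond that `log y ≥ 1`.
  have hylog : y ≤ 3 * (y * Real.log y + 1) := by
    rcases le_total y 3 with h | h
    · nlinarith [mul_nonneg (zero_le_one.trans hy) hlogy]
    · have : 1 ≤ Real.log y := by
        rw [Real.le_log_iff_exp_le (by linarith)]
        linarith [Real.exp_one_lt_d9]
      nlinarith
  rw [ht]
  nlinarith

end Analysis

/-- `L_p`-testing of monotonicity in time `O(d / ε ^ p * log (d / ε ^ p))`. -/
theorem exists_monotonicity_tester (p : ℕ) (hp : p = 1 ∨ p = 2) :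
    ∃ (c : LpTesting.Prog) (C : ℝ), ∀ (n d : ℕ) [NeZero n] (_ : 0 < d)
      (D : Fin d → PMF (Fin n)) (a b ε : ℝ) (_ : a < b) (_ : 0 < ε) (_ : ε < 1)
      (f : (Fin d → Fin n) → ℝ) (_ : ∀ x, f x ∈ Set.Icc a b),
      ∃ T : ℕ, (T : ℝ) ≤ C * ((d : ℝ) / ε ^ p * Real.log ((d : ℝ) / ε ^ p) + 1) ∧
        LpTesting.HaltsWithin c ε a b (LpTesting.prodDist D) f T ∧
        (Monotone f → 2 / 3 ≤ LpTesting.acceptProb c ε a b (LpTesting.prodDist D) f T) ∧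
        (ε < LpTesting.lpDistTo (LpTesting.prodDist D) p (b - a) f {g | Monotone g} →
          2 / 3 ≤ LpTesting.rejectProb c ε a b (LpTesting.prodDist D) f T) := by
  refine ⟨tester p, 300000, fun n d _ hd D a b ε hab hε hε1 f hf => ?_⟩
  have hd1 : (1 : ℝ) ≤ d := by exact_mod_cast hd
  have hεp : 0 < ε ^ p := pow_pos hε p
  have hεp1 : ε ^ p ≤ 1 := pow_le_one₀ hε.le hε1.le
  have hy : 1 ≤ (d : ℝ) / ε ^ p := by
    rw [le_div_iff₀ hεp]; linarith
  set N := ⌈64 * ((d : ℝ) / ε ^ p)⌉₊ with hN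
  have hNpos : 0 < N := Nat.ceil_pos.mpr (by linarith)
  have hN' : (0 : ℝ) < N := by exact_mod_cast hNpos
  have hval := le_value_tester D f hp hd a b ε (N := N) (by rw [hN, mul_div_assoc])
  have hprob : ∀ (P : ℕ → Prop) (q : ENNReal), q ≠ ⊤ →
      q.toReal ≤ (1 - surviveProb D f a b N) * (if P 0 then 1 else 0) +
        surviveProb D f a b N * (if P 1 then 1 else 0) →
      q ≤ (runTester (tester p) ε a b (prodDist D) f (testerTime N)).toOuterMeasure
        {s | s.1 = [] ∧ P (s.2.nat 0)} := fun P q hq h =>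
    (ENNReal.toReal_le_toReal hq (toOuterMeasure_ne_top _ _)).mp (h.trans (hval P))
  have htwo : ((2 : ENNReal) / 3) ≠ ⊤ := ENNReal.div_ne_top (by simp) (by simp)
  refine ⟨testerTime N, testerTime_le hy, ?_, fun hmono => ?_, fun hfar => ?_⟩
  -- Halting with probability one means halting on the whole support.
  · have h1 := le_antisymm (toOuterMeasure_le_one _ _) (hprob (fun _ => True) 1 (by simp) (by simp))
    rw [PMF.toOuterMeasure_apply_eq_one_iff] at h1
    exact fun s hs => (h1 hs).1
  · refine hprob (fun v => v = 1) _ htwo ?_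
    rw [surviveProb_eq_one_of_monotone D hmono]
    norm_num
  · refine hprob (fun v => v ≠ 1) _ htwo ?_
    have h1 := le_avgLineError D hd hab hf (fun g hg => le_sum_abs_of_lt_lpDistTo (prodDist D)
      (by omega) hab hε hf hfar hg) hNpos
    have h2 : 64 * ((d : ℝ) / ε ^ p) ≤ N := Nat.le_ceil _
    -- The constant 64 gives 32 here; quantization costs 1, leaving 31, more than the 20 required.
    have h3 : 32 ≤ N * (ε ^ p / (2 * d)) := by
      have e : 64 * ((d : ℝ) / ε ^ p) * (ε ^ p / (2 * d)) = 32 := by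
        field_simp; norm_num
      rw [← e]
      gcongr
    have h4 : N * (ε ^ p / (2 * d)) ≤ 1 + N * avgLineError D f a b N := by
      refine (mul_le_mul_of_nonneg_left h1 hN'.le).trans_eq ?_
      field_simp
    have h5 := surviveProb_le D f hd hNpos (by linarith : 20 ≤ N * avgLineError D f a b N)
    have e : ((2 : ENNReal) / 3).toReal = 2 / 3 := by simp
    rw [e]
    simp
    linarith

end LpTesting

theorem theorem1 (p : ℕ) (hp : p = 1 ∨ p = 2) :
    ∃ (c : LpTesting.Prog) (C : ℝ), ∀ (n d : ℕ) [NeZero n] (_ : 0 < d)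
      (D : Fin d → PMF (Fin n)) (a b ε : ℝ) (_ : a < b) (_ : 0 < ε) (_ : ε < 1)
      (f : (Fin d → Fin n) → ℝ) (_ : ∀ x, f x ∈ Set.Icc a b),
      ∃ T : ℕ, (T : ℝ) ≤ C * ((d : ℝ) / ε ^ p * Real.log ((d : ℝ) / ε ^ p) + 1) ∧
        LpTesting.HaltsWithin c ε a b (LpTesting.prodDist D) f T ∧
        (Monotone f → 2 / 3 ≤ LpTesting.acceptProb c ε a b (LpTesting.prodDist D) f T) ∧
        (ε < LpTesting.lpDistTo (LpTesting.prodDist D) p (b - a) f {g | Monotone g} →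
          2 / 3 ≤ LpTesting.rejectProb c ε a b (LpTesting.prodDist D) f T) := by
  exact LpTesting.exists_monotonicity_tester p hp
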